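/- A gluing of an oriented $N$-gon ($N \ge 1$) is a choice of disjoint pairs of its sides, the two sides of each pair being identified with opposite directions, so that the result is an oriented surface with one face; the remaining (unglued) sides carry pairwise distinct letters and form the boundary. Two gluings are equivalent if a rotation of the polygon carries one to the other, matching the glued pairs and the letters of the unglued sides. For integers $g \ge 0$, $L \ge 1$ and $n_1, \dots, n_L \ge 0$, fix $L$ disjoint cyclic sequences of distinct letters, of lengths $n_1, \dots, n_L$, and let $\mathcal N_{g,L}(n_1, \dots, n_L)$ be the number of equivalence classes of gluings of polygons (with any number $N\ge 1$ of sides) that produce a surface of genus $g$ with exactly $L$ polygonal boundaries, on which the prescribed cyclic sequences are read (boundaries with $n_i = 0$ being interior vertices, regarded as indistinguishable punctures). Put $\mathcal N_{g,L} = 0$ if $g < 0$ or $L \le 0$. **Lemma.** If all $n_i > 0$, then $$(L + 2g - 1)\, \mathcal N_{g,L}(n_1, \dots, n_L) = \sum_{1 \le i < j \le L} n_i n_j\, \mathcal N_{g,L-1}(n_i + n_j + 2,\ n_1, \dots, \check n_i, \dots, \check n_j, \dots, n_L) + \frac12 \sum_{i=1}^{L} n_i \sum_{x=1}^{n_i+1}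 \mathcal N_{g-1,L+1}(n_i + 2 - x,\ x,\ n_1, \dots, \check n_i, \dots, n_L),$$ where $\check n$ means that the argument is omitted. Moreover $\mathcal N_{0,1}(m) = 1$ for every $m > 0$ (the initial condition of the recursion). -/

import Mathlib

/-- A gluing of the sides of an oriented `N`-gon, with letters on the sides that stay unglued.

The sides are `0, …, N - 1` in cyclic order; side `s` runs from corner `s` to corner
`finRotate N s = s + 1`, and is followed by side `finRotate N s`.  `pair` sends a side to the side
it is glued to, and fixes the unglued sides: in terms of words along the boundary of the polygon,
two different sides are glued iff they carry the same (repeated) letter, and the names of the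
repeated letters are forgotten.  The non-repeated letters are the pairs `(i, k)` where `i` is a
boundary component and `k` one of its `n i` edges; `side` tells which side carries the letter. -/
structure PolygonGluing (N : ℕ) {ι : Type} (n : ι → ℕ) where
  /-- The side to which a given side is glued (itself if it is unglued). -/
  pair : Fin N → Fin N
  pair_pair : ∀ s, pair (pair s) = s
  /-- The unglued side that carries a given non-repeated letter. -/
  side : (Σ i, Fin (n i)) → Fin N
  side_injective : Function.Injective side
  /-- The unglued sides are exactly the ones that carry a non-repeated letter. -/
  pair_eq_iff : ∀ s, pair s = s ↔ ∃ b, side b = s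

namespace PolygonGluing

variable {N : ℕ} {ι : Type} {n : ι → ℕ}

/-- Two sides are glued along each other with opposite directions (so that the surface is
orientable): if `s` is glued to `t`, then corner `s` is identified with corner `t + 1`.
(The other identification, of `s + 1` with `t`, is the same condition for the glued side `t`.) -/
def CornerRel (G : PolygonGluing N n) (c d : Fin N) : Prop :=
  G.pair c ≠ c ∧ d = finRotate N (G.pair c)

/-- The vertices of the glued surface: corners of the polygon up to the generated
identifications. -/
def Vertex (G : PolygonGluing N n) : Type := Quot G.CornerRel

/-- The edges of the glued surface (both the glued ones and those on the boundary). -/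
def Edge (G : PolygonGluing N n) : Type := Quot (fun s t : Fin N => t = G.pair s)

/-- The interior vertices (0-gons, or punctures): the vertices that do not lie on an unglued side.
The boundary of the surface is a union of directed closed paths of unglued sides, so a vertex lies
on the boundary iff some unglued side starts there. -/
def InteriorVertex (G : PolygonGluing N n) : Type :=
  {v : G.Vertex // ∀ s, G.pair s = s → v ≠ Quot.mk G.CornerRel s}

/-- One step of the walk around a vertex or along the boundary: cross the glued side `s` (if it is
unglued, run along it), then take the next side of the polygon. -/
def walk (G : PolygonGluing N n) (s : Fin N) : Fin N := finRotate N (G.pair s)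

/-- The unglued side `t` comes next after the unglued side `s` along the boundary of the glued
surface: starting at the end of `s`, turn around the vertex, crossing glued sides, until the first
unglued side is met. -/
def BoundaryNext (G : PolygonGluing N n) (s t : Fin N) : Prop :=
  ∃ m : ℕ, G.walk^[m + 1] s = t ∧
    ∀ j, 1 ≤ j → j ≤ m → G.pair (G.walk^[j] s) ≠ G.walk^[j] s

/-- The Euler characteristic `V - E + F` of the glued surface, a cell complex with one face. -/
noncomputable def eulerChar (G : PolygonGluing N n) : ℤ :=
  (Nat.card G.Vertex : ℤ) - Nat.card G.Edge + 1

/-- The result of the gluing is a surface of genus `g` whose boundaries are labelled by `ι`,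
the `i`-th one being an `n i`-gon whose edges carry the letters `(i, 0), …, (i, n i - 1)`, in this
cyclic order.  Boundaries with `n i = 0` are the interior vertices (indistinguishable punctures),
which do not count as holes in the Euler characteristic `2 - 2 g - (number of holes)`. -/
structure Produces (G : PolygonGluing N n) (g : ℤ) : Prop where
  boundary : ∀ (i : ι) (k : Fin (n i)),
    G.BoundaryNext (G.side ⟨i, k⟩) (G.side ⟨i, finRotate (n i) k⟩)
  punctures : Nat.card G.InteriorVertex = Nat.card {i : ι // n i = 0}
  genus : G.eulerChar = 2 - 2 * g - Nat.card {i : ι // 0 < n i}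

/-- Two gluings are equivalent if a rotation of the polygon carries one to the other, matching the
glued pairs and the letters on the unglued sides. -/
def RotEquiv (G H : PolygonGluing N n) : Prop :=
  ∃ r : ℕ, (∀ s, H.pair ((finRotate N)^[r] s) = (finRotate N)^[r] (G.pair s)) ∧
    ∀ b, H.side b = (finRotate N)^[r] (G.side b)

end PolygonGluing

/-- The equivalence classes of gluings of an `N`-gon that produce a surface of genus `g` with
polygonal boundaries of `n i` edges, `i : ι`. -/
def GluingClass (g : ℤ) {ι : Type} (n : ι → ℕ) (N : ℕ) : Type :=
  Quot (fun G H : {G : PolygonGluing N n // G.Produces g} => G.1.RotEquiv H.1)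

/-- The number of equivalence classes of gluings of a polygon (with any positive number of sides)
that produce a surface of genus `g` with polygonal boundaries of `n i` edges, `i : ι`; it is `0` by
convention for `g < 0`. -/
noncomputable def gluingCount (g : ℤ) {ι : Type} (n : ι → ℕ) : ℕ :=
  if g < 0 then 0 else Nat.card (Σ N : {N : ℕ // 0 < N}, GluingClass g n N)

/-! The recursion is a double count of pairs (gluing, glued side).

When all `n i` are positive there are no interior vertices, so the surface has `∑ n i` vertices and
half of `N + ∑ n i` edges. The Euler characteristic then forces `N + 2 = ∑ n i + 2 L + 4 g`: the
number of sides is determined, and exactly `2 (L + 2 g - 1)` of them are glued. Cutting along a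
glued pair keeps `N` and makes the two sides into two new boundary letters. Either two boundaries
merge, giving one of length `n i + n j + 2` with `g` unchanged and `L` lowered by one, or one
boundary of length `n i` splits into two of total length `n i + 2`, with `g` lowered and `L` raised
by one. In both cases the relation between `N`, `g` and `L` persists.

The boundary is encoded as the first return map `τ` of the walk `finRotate ∘ α` to the unglued
sides. Gluing or cutting composes `α` with a transposition, hence composes the return map with one
and adds or removes two points. Genus thus drops out of the counting: `card_gluings_mul` sums over
all ways to insert two letters into `τ`, and the cycle structure sorts the terms into merges and
splits. A choice of side, rather than of pair, counts each merge twice and produces the factor 1/2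
in front of the splits.

The double count concerns gluings of a polygon with numbered sides. Rotations act freely on these
because a labelled side exists, so each equivalence class contains `N` of them, and the factor `N`
cancels. For `g = 0` the split terms vanish by the genus bound `IsGluing.two_mul_card_le`. -/

/-! ### First return maps -/

section FirstReturn

variable {S X Y : Type}

/-- Every point of `S` is carried into the range of `f` by the iterates of `φ`, stated as an
induction principle. -/
def Sweeps (φ : S → S) (f : X → S) : Prop :=
  ∀ T : S → Prop, (∀ x, T (f x)) → (∀ s, s ∉ Set.range f → T (φ s) → T s) → ∀ s, T s

/-- `h` sends each point to the label of the first point of the range of `f` on its forward orbit,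
and the first return map of `φ` to the range of `f` is `τ`. -/
structure FirstHit (φ : S → S) (f : X → S) (τ : X → X) (h : S → X) : Prop where
  at_range : ∀ x, h (f x) = x
  off_range : ∀ s, s ∉ Set.range f → h (φ s) = h s
  next : ∀ x, h (φ (f x)) = τ x

/-- All points are swept to the range of `f`, on which `φ` induces `τ` as first return map. -/
def Returns (φ : S → S) (f : X → S) (τ : X → X) : Prop :=
  Sweeps φ f ∧ ∃ h, FirstHit φ f τ h

theorem Returns.unique {φ : S → S} {f : X → S} {τ τ' : X → X} (h : Returns φ f τ)
    (h' : Returns φ f τ') : τ = τ' := by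
  obtain ⟨hs, k, hk⟩ := h
  obtain ⟨-, k', hk'⟩ := h'
  have key : ∀ s, k s = k' s := hs _ (fun x => by rw [hk.at_range, hk'.at_range])
    (fun s hs e => by rw [← hk.off_range s hs, e, hk'.off_range s hs])
  funext x
  rw [← hk.next, ← hk'.next, key]

/-- The walk from `s` first meets the range of `f` at `f x`. -/
inductive Hits (φ : S → S) (f : X → S) : S → X → Prop
  | here (x : X) : Hits φ f (f x) x
  | step (s : S) (x : X) : s ∉ Set.range f → Hits φ f (φ s) x → Hits φ f s x

theorem Sweeps.exists_firstHit {φ : S → S} {f : X → S} (hs : Sweeps φ f)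
    (hf : Function.Injective f) : ∃ τ h, FirstHit φ f τ h := by
  have key : ∀ s, ∃! x, Hits φ f s x := by
    refine hs _ (fun x => ⟨x, .here x, ?_⟩) ?_
    · intro y hy
      generalize e : f x = s at hy
      cases hy with
      | here => exact (hf e).symm
      | step _ _ hn => exact absurd ⟨x, e⟩ hn
    · rintro s hn ⟨x, hx, hu⟩
      refine ⟨x, .step s x hn hx, ?_⟩
      intro y hy
      cases hy with
      | here => exact absurd ⟨y, rfl⟩ hn
      | step _ _ _ h' => exact hu _ h'
  choose h hh hu using key
  refine ⟨fun x => h (φ (f x)), h, ⟨fun x => ?_, fun s hn => ?_, fun x => rfl⟩⟩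
  · exact (hu _ _ (.here x)).symm
  · exact hu _ _ (.step s _ hn (hh _))

/-- If `y` were not a value of the return map, the inverse of `φ` would map the finite fibre `h = y`
injectively into itself while missing `f y`. -/
theorem Sweeps.exists_returns_perm [Finite S] [Finite X] {φ : S → S} {f : X → S}
    (hs : Sweeps φ f) (hφ : Function.Injective φ) (hf : Function.Injective f) :
    ∃ τ : Equiv.Perm X, Returns φ f τ := by
  obtain ⟨τ, h, hh⟩ := hs.exists_firstHit hf
  have hsurj : Function.Surjective τ := by
    intro y
    by_contra hy
    push Not at hy
    have hsub : ∀ u, h (φ u) = y → h u = y ∧ u ≠ f y := by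
      intro u hu
      by_cases hr : u ∈ Set.range f
      · obtain ⟨x, rfl⟩ := hr
        exact absurd (by rw [← hh.next, hu]) (hy x)
      · exact ⟨by rw [← hh.off_range u hr, hu], fun e => hr ⟨y, e.symm⟩⟩
    have hφs : Function.Surjective φ := Finite.surjective_of_injective hφ
    choose g hg using hφs
    have hginj : Function.Injective g := fun a b e => by rw [← hg a, ← hg b, e]
    let G : {u // h u = y} → {u // h u = y} := fun u =>
      ⟨g u, (hsub (g u) (by rw [hg]; exact u.2)).1⟩
    have hG : Function.Injective G := fun a b e =>
      Subtype.ext (hginj (congrArg Subtype.val e))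
    obtain ⟨u, hu⟩ := Finite.surjective_of_injective hG ⟨f y, hh.at_range y⟩
    exact (hsub (g u) (by rw [hg]; exact u.2)).2 (congrArg Subtype.val hu)
  exact ⟨Equiv.ofBijective τ ⟨Finite.injective_iff_surjective.2 hsurj, hsurj⟩, hs, h, hh⟩

theorem Sweeps.congr {φ ψ : S → S} {f : X → S} (hs : Sweeps φ f)
    (e : ∀ s, s ∉ Set.range f → ψ s = φ s) : Sweeps ψ f :=
  fun T h1 h2 => hs T h1 fun s hn h => h2 s hn (by rw [e s hn]; exact h)

/-- Changing the walk only at marked points changes only the first step of each excursion. Applied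
to transpositions, this describes gluing and cutting. -/
theorem Returns.precomp {φ ψ : S → S} {f : X → S} {τ : X → X} (hr : Returns φ f τ) (π : X → X)
    (e : ∀ s, s ∉ Set.range f → ψ s = φ s) (e' : ∀ x, ψ (f x) = φ (f (π x))) :
    Returns ψ f (τ ∘ π) := by
  obtain ⟨hs, h, hh⟩ := hr
  exact ⟨hs.congr e, h, hh.at_range, fun s hn => by rw [e s hn, hh.off_range s hn],
    fun x => by rw [e', hh.next]; rfl⟩

theorem Returns.conj {φ : S → S} {f : X → S} {τ : X → X} (hr : Returns φ f τ) (c : Equiv.Perm S)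
    {ψ : S → S} (e : ∀ s, ψ (c s) = c (φ s)) : Returns ψ (c ∘ f) τ := by
  obtain ⟨hs, h, hh⟩ := hr
  have hrange : ∀ s, c s ∉ Set.range (c ∘ f) → s ∉ Set.range f := by
    rintro s hn ⟨x, rfl⟩
    exact hn ⟨x, rfl⟩
  refine ⟨fun T h1 h2 s => ?_, h ∘ c.symm, fun x => ?_, fun s hn => ?_, fun x => ?_⟩
  · have := hs (fun s => T (c s)) h1 (fun s hn ht => h2 (c s) ?_ (by rw [e]; exact ht)) (c.symm s)
    · simpa using this
    · rintro ⟨x, hx⟩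
      exact hn ⟨x, c.injective hx⟩
  · simp [hh.at_range]
  · obtain ⟨s, rfl⟩ := c.surjective s
    simp [e, hh.off_range s (hrange s hn)]
  · simp [e, hh.next]

theorem Returns.relabel {φ : S → S} {f : X → S} {τ : X → X} (hr : Returns φ f τ) (k : Y ≃ X)
    {τ' : Y → Y} (e : ∀ y, k (τ' y) = τ (k y)) : Returns φ (f ∘ k) τ' := by
  obtain ⟨hs, h, hh⟩ := hr
  have hrange : Set.range (f ∘ k) = Set.range f := k.surjective.range_comp f
  refine ⟨fun T h1 h2 => hs T (fun x => ?_) (fun s hn => h2 s (by rwa [hrange])),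
    k.symm ∘ h, fun x => ?_, fun s hn => ?_, fun x => ?_⟩
  · simpa using h1 (k.symm x)
  · simp [hh.at_range]
  · simp [hh.off_range s (by rwa [← hrange])]
  · simp [hh.next, ← e]

theorem Sweeps.of_comp_some {φ : S → S} {f : Option X → S} (hs : Sweeps φ (f ∘ some)) :
    Sweeps φ f := by
  refine fun T h1 h2 => hs T (fun x => h1 _) fun s hn ht => ?_
  by_cases hr : s ∈ Set.range f
  · obtain ⟨x, rfl⟩ := hr
    exact h1 x
  · exact h2 s hr ht

theorem Option.not_mem_range_of_comp_some {f : Option X → S} {s : S}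
    (hn : s ∉ Set.range (f ∘ some)) (hs : s ≠ f none) : s ∉ Set.range f := by
  rintro ⟨_ | x, rfl⟩
  · exact hs rfl
  · exact hn ⟨x, rfl⟩

theorem Returns.removeNone {φ : S → S} {f : Option X → S} {σ : Equiv.Perm (Option X)}
    (hr : Returns φ f σ) (hf : Function.Injective f) (hσ : σ none ≠ none) :
    Returns φ (f ∘ some) (Equiv.removeNone σ) := by
  obtain ⟨hs, h, hh⟩ := hr
  obtain ⟨a, ha⟩ := Option.ne_none_iff_exists'.1 hσ
  -- An orbit that meets `f none` first goes on to `f (some a)`, hence the default value `a`.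
  refine ⟨fun T h1 h2 => ?_, fun s => (h s).getD a, fun x => ?_, fun s hn => ?_, fun x => ?_⟩
  · have key : ∀ u, h u ≠ none → T u := by
      refine hs _ ?_ ?_
      · rintro (_ | x) hx
        · exact absurd (hh.at_range _) hx
        · exact h1 x
      · intro s hn ht hs'
        refine h2 s (fun ⟨x, hx⟩ => hn ⟨_, hx⟩) (ht ?_)
        rwa [hh.off_range s hn]
    have hnone : T (f none) := by
      refine h2 _ ?_ (key _ (by rw [hh.next]; exact hσ))
      rintro ⟨x, hx⟩
      exact Option.some_ne_none x (hf hx)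
    refine hs T ?_ fun s hn => h2 s (fun ⟨x, hx⟩ => hn ⟨_, hx⟩)
    rintro (_ | x)
    · exact hnone
    · exact h1 x
  · simp [hh.at_range]
  · by_cases e : s = f none
    · subst e
      simp [hh.next, hh.at_range, ha]
    · simp [hh.off_range s (Option.not_mem_range_of_comp_some hn e)]
  · simp only [Function.comp_apply, hh.next]
    apply Option.some_injective
    cases hx : σ (some x) with
    | none => rw [Equiv.removeNone_none σ hx, ha]; rfl
    | some y => rw [Equiv.removeNone_some σ ⟨y, hx⟩, hx]; rfl

/-- Otherwise the orbit of `f none` would return to `f none` forever and never reach the other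
marked points. -/
theorem Returns.apply_none_ne_none {φ : S → S} {f : Option X → S} {σ : Option X → Option X}
    (hr : Returns φ f σ) (hs : Sweeps φ (f ∘ some)) : σ none ≠ none := by
  intro hσ
  obtain ⟨-, h, hh⟩ := hr
  refine hs (fun u => h u ≠ none) ?_ ?_ (f none) (hh.at_range none)
  · intro x
    simp [hh.at_range]
  · intro s hn ht
    by_cases e : s = f none
    · subst e
      exact absurd (by rw [hh.next, hσ]) ht
    · rwa [← hh.off_range s (Option.not_mem_range_of_comp_some hn e)]

end FirstReturn

/-! ### Cutting and gluing a pair of sides -/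

section Count

open Equiv

variable {N : ℕ} {X Y : Type}

/-- A gluing `α` of the sides of an `N`-gon without interior vertices, whose unglued sides are
labelled by `f`, the cyclic sequences of labels on the boundaries being the cycles of `τ`. -/
structure IsGluing (τ : X → X) (α : Fin N → Fin N) (f : X → Fin N) : Prop where
  involutive : Function.Involutive α
  injective : Function.Injective f
  fixed_iff : ∀ s, α s = s ↔ s ∈ Set.range f
  returns : Returns (fun s => finRotate N (α s)) f τ

/-- The type of gluings of an `N`-gon with boundary permutation `τ`. -/
abbrev Gluings (N : ℕ) (τ : X → X) : Type :=
  {q : (Fin N → Fin N) × (X → Fin N) // IsGluing τ q.1 q.2}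

theorem IsGluing.relabel {τ : X → X} {α : Fin N → Fin N} {f : X → Fin N} (h : IsGluing τ α f)
    (k : Y ≃ X) {τ' : Y → Y} (e : ∀ y, k (τ' y) = τ (k y)) : IsGluing τ' α (f ∘ k) where
  involutive := h.involutive
  injective := h.injective.comp k.injective
  fixed_iff s := by rw [h.fixed_iff, k.surjective.range_comp f]
  returns := h.returns.relabel k e

theorem card_gluings_congr (k : Y ≃ X) {τ : X → X} {τ' : Y → Y} (e : ∀ y, k (τ' y) = τ (k y)) :
    Nat.card (Gluings N τ) = Nat.card (Gluings N τ') := by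
  have e' : ∀ x, k.symm (τ x) = τ' (k.symm x) := fun x => by
    apply k.injective
    simp [e]
  refine Nat.card_congr ⟨fun q => ⟨(q.1.1, q.1.2 ∘ k), q.2.relabel k e⟩,
    fun q => ⟨(q.1.1, q.1.2 ∘ k.symm), q.2.relabel k.symm e'⟩, fun q => ?_, fun q => ?_⟩
  · apply Subtype.ext
    simp [Function.comp_assoc]
  · apply Subtype.ext
    simp [Function.comp_assoc]

theorem IsGluing.card_glued [Finite X] {τ : X → X} {α : Fin N → Fin N} {f : X → Fin N}
    (h : IsGluing τ α f) : Nat.card {s // α s ≠ s} + Nat.card X = N := by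
  classical
  have e : Nat.card X = Nat.card {s // α s = s} := by
    refine Nat.card_congr ((Equiv.ofInjective f h.injective).trans (Equiv.subtypeEquivRight ?_))
    intro s
    exact (h.fixed_iff s).symm
  rw [e, add_comm, ← Nat.card_sum, Nat.card_congr (Equiv.sumCompl _), Nat.card_fin]

/-- The permutation `τ` with two new points inserted into its cycles: `none` before `a`, then
another one before `y`. -/
def insertTwo (τ : Perm X) [DecidableEq X] (a : X) (y : Option X) : Perm (Option (Option X)) :=
  Perm.decomposeOption.symm (some y, Perm.decomposeOption.symm (some a, τ))

/-- The boundary permutation that becomes `τ` when the sides `none` and `some none` are glued. -/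
def unglue (τ : Perm X) [DecidableEq X] (a : X) (y : Option X) : Perm (Option (Option X)) :=
  insertTwo τ a y * swap none (some none)

theorem decomposeOption_symm_apply_none [DecidableEq X] (a : X) (τ : Perm X) :
    Perm.decomposeOption.symm (some a, τ) none = some a := by
  simp [Perm.decomposeOption_symm_apply]

theorem removeNone_decomposeOption_symm [DecidableEq X] (a : Option X) (τ : Perm X) :
    removeNone (Perm.decomposeOption.symm (a, τ)) = τ :=
  congrArg Prod.snd (Perm.decomposeOption.apply_symm_apply (a, τ))

theorem eq_decomposeOption_symm [DecidableEq X] {σ : Perm (Option X)} {a : X}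
    (h : σ none = some a) : σ = Perm.decomposeOption.symm (some a, removeNone σ) := by
  rw [← h]
  exact (Perm.decomposeOption.symm_apply_apply σ).symm

theorem unglue_injective [DecidableEq X] (τ : Perm X) {a a' : X} {y y' : Option X}
    (h : unglue τ a y = unglue τ a' y') : a = a' ∧ y = y' := by
  have h := Perm.decomposeOption.symm.injective (mul_right_cancel h)
  simp only [Prod.mk.injEq, Option.some.injEq, EmbeddingLike.apply_eq_iff_eq, and_true] at h
  exact ⟨h.2, h.1⟩

section Involution

variable {S : Type} [DecidableEq S] {α : S → S} {p q : S}

theorem involutive_comp_swap_of_fixed (h : Function.Involutive α) (hp : α p = p) (hq : α q = q) :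
    Function.Involutive (fun u => α (swap p q u)) := by
  intro u
  have hα := h u
  have hinj := h.injective
  by_cases h1 : u = p
  · subst h1; simp [hp, hq]
  by_cases h2 : u = q
  · subst h2; simp [hp, hq]
  have h3 : α u ≠ p := fun e => h1 (hinj (e.trans hp.symm))
  have h4 : α u ≠ q := fun e => h2 (hinj (e.trans hq.symm))
  simp [swap_apply_of_ne_of_ne h1 h2, swap_apply_of_ne_of_ne h3 h4, hα]

theorem comp_swap_eq_self_iff_of_fixed (hp : α p = p) (hq : α q = q)
    (hpq : p ≠ q) (u : S) : α (swap p q u) = u ↔ α u = u ∧ u ≠ p ∧ u ≠ q := by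
  by_cases h1 : u = p
  · subst h1; simp [hq, hpq.symm]
  by_cases h2 : u = q
  · subst h2; simp [hp, hpq]
  simp [swap_apply_of_ne_of_ne h1 h2, h1, h2]

theorem involutive_comp_swap_of_swapped (h : Function.Involutive α) (hp : α p = q) :
    Function.Involutive (fun u => α (swap p q u)) := by
  intro u
  have hα := h u
  have hinj := h.injective
  have hq : α q = p := by rw [← hp, h]
  by_cases h1 : u = p
  · subst h1; simp [hq]
  by_cases h2 : u = q
  · subst h2; simp [hp]
  have h3 : α u ≠ p := fun e => h2 (hinj (e.trans hq.symm))
  have h4 : α u ≠ q := fun e => h1 (hinj (e.trans hp.symm))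
  simp [swap_apply_of_ne_of_ne h1 h2, swap_apply_of_ne_of_ne h3 h4, hα]

theorem comp_swap_eq_self_iff_of_swapped (h : Function.Involutive α) (hp : α p = q) (u : S) :
    α (swap p q u) = u ↔ α u = u ∨ u = p ∨ u = q := by
  have hq : α q = p := by rw [← hp, h]
  by_cases h1 : u = p
  · subst h1; simp [hq]
  by_cases h2 : u = q
  · subst h2; simp [hp]
  simp [swap_apply_of_ne_of_ne h1 h2, h1, h2]

end Involution

theorem range_option_option {S : Type} (f : Option (Option X) → S) (s : S) :
    s ∈ Set.range f ↔ s ∈ Set.range ((f ∘ some) ∘ some) ∨ s = f none ∨ s = f (some none) := by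
  constructor
  · rintro ⟨_ | _ | x, rfl⟩
    · exact Or.inr (Or.inl rfl)
    · exact Or.inr (Or.inr rfl)
    · exact Or.inl ⟨x, rfl⟩
  · rintro (⟨x, rfl⟩ | rfl | rfl) <;> exact ⟨_, rfl⟩

/-- Gluing the two sides `none` and `some none`. -/
theorem IsGluing.glue [DecidableEq X] {τ : Perm X} {a : X} {y : Option X} {α : Fin N → Fin N}
    {f : Option (Option X) → Fin N} (h : IsGluing (unglue τ a y) α f) :
    IsGluing τ (fun u => α (swap (f none) (f (some none)) u)) ((f ∘ some) ∘ some) := by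
  have hp : α (f none) = f none := (h.fixed_iff _).2 ⟨_, rfl⟩
  have hq : α (f (some none)) = f (some none) := (h.fixed_iff _).2 ⟨_, rfl⟩
  have hpq : f none ≠ f (some none) := fun e => by simpa using h.injective e
  have hi1 : Function.Injective (f ∘ some) := h.injective.comp (Option.some_injective _)
  refine ⟨involutive_comp_swap_of_fixed h.involutive hp hq, hi1.comp (Option.some_injective _),
    fun s => ?_, ?_⟩
  · rw [comp_swap_eq_self_iff_of_fixed hp hq hpq, h.fixed_iff, range_option_option]
    constructor
    · rintro ⟨h1 | h1 | h1, h2, h3⟩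
      · exact h1
      · exact absurd h1 h2
      · exact absurd h1 h3
    · rintro ⟨x, rfl⟩
      refine ⟨Or.inl ⟨x, rfl⟩, ?_, ?_⟩ <;> intro e <;> simpa using h.injective e
  · have h1 : Returns (fun s => finRotate N (α (swap (f none) (f (some none)) s))) f
        (insertTwo τ a y) := by
      have := h.returns.precomp (swap none (some none))
        (ψ := fun s => finRotate N (α (swap (f none) (f (some none)) s))) ?_ ?_
      · convert this using 1
        funext x
        simp [unglue]
      · intro s hn
        rw [swap_apply_of_ne_of_ne] <;> rintro rfl <;> exact hn ⟨_, rfl⟩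
      · intro x
        rw [h.injective.swap_apply]
    have h2 := h1.removeNone h.injective
      (by rw [insertTwo, decomposeOption_symm_apply_none]; exact Option.some_ne_none _)
    rw [insertTwo, removeNone_decomposeOption_symm] at h2
    have h3 := h2.removeNone hi1
      (by rw [decomposeOption_symm_apply_none]; exact Option.some_ne_none _)
    rwa [removeNone_decomposeOption_symm] at h3

/-- Cutting along a glued pair of sides. -/
theorem IsGluing.exists_unglue [Finite X] [DecidableEq X] {τ : Perm X} {α : Fin N → Fin N}
    {f : X → Fin N} (h : IsGluing τ α f) {s : Fin N} (hs : α s ≠ s) :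
    ∃ (a : X) (y : Option X) (f' : Option (Option X) → Fin N),
      IsGluing (unglue τ a y) (fun u => α (swap s (α s) u)) f' ∧ f' none = α s ∧
        f' (some none) = s ∧ (f' ∘ some) ∘ some = f := by
  let f' : Option (Option X) → Fin N := fun z => z.elim (α s) fun z => z.elim s f
  have hns : s ∉ Set.range f := fun e => hs ((h.fixed_iff s).2 e)
  have hnt : α s ∉ Set.range f := fun e => hs (h.involutive.injective ((h.fixed_iff _).2 e))
  have hi1 : Function.Injective (f' ∘ some) := by
    rintro (_ | x) (_ | x') e
    · rfl
    · exact absurd ⟨x', e.symm⟩ hns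
    · exact absurd ⟨x, e⟩ hns
    · exact congrArg some (h.injective e)
  have hi : Function.Injective f' := by
    rintro (_ | _ | x) (_ | _ | x') e
    · rfl
    · exact absurd e hs
    · exact absurd ⟨x', e.symm⟩ hnt
    · exact absurd e.symm hs
    · rfl
    · exact absurd ⟨x', e.symm⟩ hns
    · exact absurd ⟨x, e⟩ hnt
    · exact absurd ⟨x, e⟩ hns
    · exact congrArg _ (congrArg _ (h.injective e))
  have hsw : Sweeps (fun u => finRotate N (α u)) ((f' ∘ some) ∘ some) := h.returns.1
  have hφ : Function.Injective (fun u => finRotate N (α u)) :=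
    (finRotate N).injective.comp h.involutive.injective
  -- `σ` is the return map of the uncut walk, with both glued sides marked as well. Forgetting them
  -- recovers `τ`, so `σ` is `τ` with two points inserted.
  obtain ⟨σ, hσ⟩ := hsw.of_comp_some.of_comp_some.exists_returns_perm hφ hi
  have hn := hσ.apply_none_ne_none hsw.of_comp_some
  have h1 := hσ.removeNone hi hn
  have hn1 := h1.apply_none_ne_none hsw
  have h2 := DFunLike.coe_injective ((h1.removeNone hi1 hn1).unique h.returns)
  obtain ⟨y, hy⟩ := Option.ne_none_iff_exists'.1 hn
  obtain ⟨a, ha⟩ := Option.ne_none_iff_exists'.1 hn1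
  have e : σ = insertTwo τ a y := by
    rw [eq_decomposeOption_symm hy, eq_decomposeOption_symm ha, h2, insertTwo]
  refine ⟨a, y, f', ⟨involutive_comp_swap_of_swapped h.involutive rfl, hi, fun u => ?_, ?_⟩,
    rfl, rfl, rfl⟩
  · rw [comp_swap_eq_self_iff_of_swapped h.involutive rfl, h.fixed_iff, range_option_option,
      or_comm (a := u = s)]
    rfl
  · have := hσ.precomp (swap none (some none))
      (ψ := fun u => finRotate N (α (swap s (α s) u))) ?_ ?_
    · rw [e] at this
      exact this
    · intro u hn
      rw [swap_apply_of_ne_of_ne]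
      · rintro rfl; exact hn ⟨some none, rfl⟩
      · rintro rfl; exact hn ⟨none, rfl⟩
    · intro x
      rw [← hi.swap_apply, swap_comm]
      rfl

/-- Both sides count gluings with a distinguished glued side: each has `N - |X|` glued sides, and
cutting at the chosen one is inverse to gluing `none` to `some none`, with the chosen side labelled
`some none`. -/
theorem card_gluings_mul [Fintype X] [DecidableEq X] (τ : Perm X) :
    ((N : ℤ) - Fintype.card X) * Nat.card (Gluings N τ) =
      ∑ a : X, ∑ y : Option X, (Nat.card (Gluings N (unglue τ a y)) : ℤ) := by
  let T := {p : ((Fin N → Fin N) × (X → Fin N)) × Fin N //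
    IsGluing τ p.1.1 p.1.2 ∧ p.1.1 p.2 ≠ p.2}
  let F : (Σ p : X × Option X, Gluings N (unglue τ p.1 p.2)) → T := fun r =>
    ⟨((fun u => r.2.1.1 (swap (r.2.1.2 none) (r.2.1.2 (some none)) u),
      (r.2.1.2 ∘ some) ∘ some), r.2.1.2 (some none)), r.2.2.glue, by
      have h := r.2.2
      rw [ne_eq, comp_swap_eq_self_iff_of_fixed ((h.fixed_iff _).2 ⟨_, rfl⟩)
        ((h.fixed_iff _).2 ⟨_, rfl⟩) (fun e => by simpa using h.injective e)]
      simp⟩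
  have hF : Function.Bijective F := by
    constructor
    · rintro ⟨⟨a, y⟩, ⟨⟨α, f⟩, h⟩⟩ ⟨⟨a', y'⟩, ⟨⟨α', f'⟩, h'⟩⟩ e
      dsimp only at h h'
      obtain ⟨e1, e5⟩ := Prod.mk.inj (congrArg Subtype.val e)
      obtain ⟨e3, e4⟩ := Prod.mk.inj e1
      have e5 : f (some none) = f' (some none) := e5
      dsimp only at e3 e4
      have hp : α (f none) = f none := (h.fixed_iff _).2 ⟨_, rfl⟩
      have hp' : α' (f' none) = f' none := (h'.fixed_iff _).2 ⟨_, rfl⟩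
      -- The side labelled `none` is recovered as the partner of the distinguished side.
      have e6 : f none = f' none := by
        have h1 := congrFun e3 (f (some none))
        simp only [swap_apply_right, hp] at h1
        rw [h1, e5]
        simp [hp']
      have e7 : f = f' := by
        funext z
        rcases z with _ | _ | x
        · exact e6
        · exact e5
        · exact congrFun e4 x
      subst e7
      have e8 : α = α' := by
        funext u
        have := congrFun e3 (swap (f none) (f (some none)) u)
        simpa using this
      subst e8
      obtain ⟨rfl, rfl⟩ := unglue_injective τ (DFunLike.coe_injective (h.returns.unique h'.returns))
      rfl
    · rintro ⟨⟨⟨α, f⟩, s⟩, h, hs⟩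
      dsimp only at h hs
      obtain ⟨a, y, f', h', e1, e2, e3⟩ := h.exists_unglue hs
      have e4 : (fun u => α (swap s (α s) (swap (f' none) (f' (some none)) u))) = α := by
        funext u
        rw [e1, e2, swap_comm s]
        simp
      exact ⟨⟨(a, y), ⟨(_, f'), h'⟩⟩, Subtype.ext (Prod.ext (Prod.ext e4 e3) e2)⟩
  let E : T ≃ Σ q : Gluings N τ, {s // q.1.1 s ≠ s} :=
    ⟨fun p => ⟨⟨p.1.1, p.2.1⟩, ⟨p.1.2, p.2.2⟩⟩, fun q => ⟨(q.1.1, q.2.1), q.1.2, q.2.2⟩,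
      fun _ => rfl, fun _ => rfl⟩
  have hc := (Nat.card_eq_of_bijective F hF).trans (Nat.card_congr E)
  have : Fintype (Gluings N τ) := Fintype.ofFinite _
  rw [Nat.card_sigma, Nat.card_sigma, Fintype.sum_prod_type] at hc
  have hq : ∀ q : Gluings N τ, (Nat.card {s // q.1.1 s ≠ s} : ℤ) = N - Fintype.card X := by
    intro q
    have := q.2.card_glued
    rw [Nat.card_eq_fintype_card (α := X)] at this
    omega
  have hc := congrArg (Nat.cast : ℕ → ℤ) hc
  push_cast at hc
  rw [hc, Finset.sum_congr rfl fun q _ => hq q, Finset.sum_const, nsmul_eq_mul, mul_comm,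
    Nat.card_eq_fintype_card, Finset.card_univ]

end Count

/-! ### Cycle structure after cutting -/

section Cycles

open Equiv

variable {N : ℕ} {X Y ι : Type}

/-- The cycles of `τ` are indexed by `ι`; the `i`-th one has `n i` points and contains `b i`. -/
structure IsCycleBase [Fintype ι] (τ : Perm Y) (n : ι → ℕ) (b : ι → Y) : Prop where
  exists_eq : ∀ y, ∃ i k, k < n i ∧ (τ ^ k) (b i) = y
  card : Nat.card Y = ∑ i, n i
  period : ∀ i, (τ ^ n i) (b i) = b i

/-- The permutation that rotates each of the cyclic sequences `0, …, n i - 1`. -/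
def blockRotate (n : ι → ℕ) : Perm (Σ i, Fin (n i)) :=
  Equiv.sigmaCongrRight fun i => finRotate (n i)

theorem blockRotate_apply (n : ι → ℕ) (i : ι) (k : Fin (n i)) :
    blockRotate n ⟨i, k⟩ = ⟨i, finRotate (n i) k⟩ := rfl

theorem blockRotate_pow_apply (n : ι → ℕ) (i : ι) (k : Fin (n i)) (m : ℕ) :
    (blockRotate n ^ m) ⟨i, k⟩ = ⟨i, (finRotate (n i) ^ m) k⟩ := by
  induction m with
  | zero => rfl
  | succ m ih => rw [pow_succ', pow_succ', Perm.mul_apply, ih]; rfl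

theorem finRotate_pow_val {m : ℕ} (l : Fin m) (k : ℕ) :
    ((finRotate m ^ k) l : ℕ) = (l + k) % m := by
  induction k with
  | zero => simp [Nat.mod_eq_of_lt l.2]
  | succ k ih =>
    rcases m with _ | m
    · exact l.elim0
    rw [pow_succ', Perm.mul_apply, finRotate_apply, Fin.val_add, ih, ← add_assoc]
    simp [Nat.add_mod]

theorem finRotate_pow_self {m : ℕ} (l : Fin m) : (finRotate m ^ m) l = l := by
  apply Fin.ext
  rw [finRotate_pow_val, Nat.add_mod_right, Nat.mod_eq_of_lt l.2]

theorem exists_finRotate_pow {m : ℕ} (l l' : Fin m) : ∃ k < m, (finRotate m ^ k) l = l' := by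
  have hm : 0 < m := l.pos
  refine ⟨(l' + (m - l)) % m, Nat.mod_lt _ hm, Fin.ext ?_⟩
  rw [finRotate_pow_val, Nat.add_mod_mod, show (l : ℕ) + (l' + (m - l)) = l' + m by omega,
    Nat.add_mod_right, Nat.mod_eq_of_lt l'.2]

theorem isCycleBase_blockRotate [Fintype ι] (n : ι → ℕ) (l : ∀ i, Fin (n i)) :
    IsCycleBase (blockRotate n) n (fun i => ⟨i, l i⟩) where
  exists_eq := by
    rintro ⟨i, l'⟩
    obtain ⟨k, hk, e⟩ := exists_finRotate_pow (l i) l'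
    exact ⟨i, k, hk, by rw [blockRotate_pow_apply, e]⟩
  card := by simp
  period i := by rw [blockRotate_pow_apply, finRotate_pow_self]

namespace IsCycleBase

variable [Fintype ι] {τ : Perm Y} {n : ι → ℕ} {b : ι → Y}

theorem bijective (h : IsCycleBase τ n b) :
    Function.Bijective fun p : Σ i, Fin (n i) => (τ ^ (p.2 : ℕ)) (b p.1) := by
  have hs : Function.Surjective fun p : Σ i, Fin (n i) => (τ ^ (p.2 : ℕ)) (b p.1) := by
    intro y
    obtain ⟨i, k, hk, e⟩ := h.exists_eq y
    exact ⟨⟨i, k, hk⟩, e⟩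
  have : Finite Y := Finite.of_surjective _ hs
  exact hs.bijective_of_nat_card_le (by rw [h.card]; simp)

theorem pow_mod (h : IsCycleBase τ n b) (i : ι) (k : ℕ) :
    (τ ^ (k % n i)) (b i) = (τ ^ k) (b i) := by
  have key : ∀ q, (τ ^ (n i * q)) (b i) = b i := by
    intro q
    induction q with
    | zero => simp
    | succ q ih => rw [Nat.mul_succ, pow_add, Perm.mul_apply, h.period, ih]
  conv_rhs => rw [← Nat.mod_add_div k (n i), pow_add, Perm.mul_apply, key]

theorem eq_of_pow_eq (h : IsCycleBase τ n b) {i j : ι} {k m : ℕ} (hk : k < n i) (hm : m < n j)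
    (e : (τ ^ k) (b i) = (τ ^ m) (b j)) : i = j ∧ k = m := by
  have := h.bijective.1 (a₁ := ⟨i, k, hk⟩) (a₂ := ⟨j, m, hm⟩) e
  have h1 := congrArg Sigma.fst this
  dsimp only at h1
  subst h1
  simpa using this

theorem pow_ne (h : IsCycleBase τ n b) (hn : ∀ i, 0 < n i) {i j : ι} (hij : i ≠ j) (k m : ℕ) :
    (τ ^ k) (b i) ≠ (τ ^ m) (b j) := by
  rw [← h.pow_mod i, ← h.pow_mod j]
  exact fun e => hij (h.eq_of_pow_eq (Nat.mod_lt _ (hn i)) (Nat.mod_lt _ (hn j)) e).1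

/-- The count depends only on the cycle type: `(i, k) ↦ τ ^ k (b i)` conjugates `blockRotate n` to
`τ`. -/
theorem card_gluings (h : IsCycleBase τ n b) :
    Nat.card (Gluings N τ) = Nat.card (Gluings N (blockRotate n)) := by
  refine card_gluings_congr (Equiv.ofBijective _ h.bijective) ?_
  rintro ⟨i, k⟩
  have hi : 0 < n i := k.pos
  simp only [Equiv.ofBijective_apply, blockRotate_apply]
  have e : ((finRotate (n i) k : Fin (n i)) : ℕ) = (k + 1) % n i := finRotate_pow_val k 1
  rw [e, h.pow_mod, pow_succ', Perm.mul_apply]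

end IsCycleBase

section Unglue

variable [DecidableEq X] {τ : Perm X} {a x : X} {y : Option X}

theorem decomposeOption_symm_apply_some (c z : X) (π : Perm X) :
    Perm.decomposeOption.symm (some c, π) (some z) = if π z = c then none else some (π z) := by
  split_ifs with h
  · simp [Perm.decomposeOption_symm_apply, h]
  · rw [Perm.decomposeOption_symm_apply]
    simp only [Perm.mul_apply, optionCongr_apply, Option.map_some]
    exact swap_apply_of_ne_of_ne (by simp) (by simpa using h)

theorem unglue_some_none (τ : Perm X) (a : X) (y : Option X) :
    unglue τ a y (some none) = some y := by
  simp [unglue, insertTwo]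

theorem unglue_none (τ : Perm X) (a : X) (y : Option X) :
    unglue τ a y none = if some a = y then none else some (some a) := by
  simp only [unglue, insertTwo, Perm.mul_apply, swap_apply_left]
  cases y <;>
    rw [decomposeOption_symm_apply_some, decomposeOption_symm_apply_none]

theorem unglue_some_some (τ : Perm X) (a x : X) (y : Option X) :
    unglue τ a y (some (some x)) =
      if (if τ x = a then none else some (τ x)) = y then none else
        some (if τ x = a then none else some (τ x)) := by
  have e : swap none (some none) (some (some x)) = some (some x) :=
    swap_apply_of_ne_of_ne (by simp) (by simp)
  simp only [unglue, insertTwo, Perm.mul_apply, e, decomposeOption_symm_apply_some]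

theorem unglue_of_ne (h1 : τ x ≠ a) (h2 : some (τ x) ≠ y) :
    unglue τ a y (some (some x)) = some (some (τ x)) := by
  simp [unglue_some_some, h1, h2]

end Unglue

/-- Traces an arc of a new cycle: from `p` it enters an orbit of `τ` at `q`, follows `M` of its
points and leaves for `r`. -/
theorem pow_succ_apply_of_chain {Z : Type} {ρ : Perm Z} {τ : Perm X} {g : X → Z} {p r : Z} {q : X}
    {M : ℕ} (hM : 0 < M) (h0 : ρ p = g q)
    (hs : ∀ m, m + 1 < M → ρ (g ((τ ^ m) q)) = g ((τ ^ (m + 1)) q))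
    (hr : ρ (g ((τ ^ (M - 1)) q)) = r) :
    (∀ m < M, (ρ ^ (m + 1)) p = g ((τ ^ m) q)) ∧ (ρ ^ (M + 1)) p = r := by
  have h : ∀ m < M, (ρ ^ (m + 1)) p = g ((τ ^ m) q) := by
    intro m hm
    induction m with
    | zero => simpa using h0
    | succ m ih => rw [pow_succ', Perm.mul_apply, ih (by omega), hs m hm]
  refine ⟨h, ?_⟩
  obtain ⟨m, rfl⟩ : ∃ m, M = m + 1 := ⟨M - 1, by omega⟩
  rw [pow_succ', Perm.mul_apply, h m (by omega)]
  exact hr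

theorem IsCycleBase.unglue_pow_of_ne [Fintype ι] [DecidableEq X] {τ : Perm X} {n : ι → ℕ}
    {b : ι → X} (h : IsCycleBase τ n b) (hn : ∀ i, 0 < n i) {i j k : ι} (hi : k ≠ i) (hj : k ≠ j)
    {y : Option X} (hy : ∀ c, y = some c → ∃ m, c = (τ ^ m) (b j)) (m : ℕ) :
    (unglue τ (b i) y ^ m) (some (some (b k))) = some (some ((τ ^ m) (b k))) := by
  induction m with
  | zero => rfl
  | succ m ih =>
    have e : τ ((τ ^ m) (b k)) = (τ ^ (m + 1)) (b k) := by rw [pow_succ', Perm.mul_apply]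
    rw [pow_succ', Perm.mul_apply, ih, ← e]
    apply unglue_of_ne <;> rw [e]
    · exact h.pow_ne hn hi (m + 1) 0
    · intro e
      obtain ⟨m', hm'⟩ := hy _ e.symm
      exact h.pow_ne hn hj (m + 1) m' hm'

/-- The new cycle is `some none`, then the `j`-th cycle from `b j`, then `none`, then the `i`-th
cycle from `b i`. -/
theorem IsCycleBase.merge [Fintype ι] [DecidableEq X] [Finite X] {τ : Perm X} {n : ι → ℕ}
    {b : ι → X} (h : IsCycleBase τ n b) (hn : ∀ i, 0 < n i) {i j : ι} (hij : i ≠ j)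
    {p : ι → Prop} [Fintype {k // p k}] (hp : ∀ k, p k ↔ k ≠ i ∧ k ≠ j) {m : ℕ}
    (hm : m = n i + n j + 2) :
    IsCycleBase (unglue τ (b i) (some (b j)))
      (Sum.elim ![m] fun k : {k // p k} => n k)
      (Sum.elim ![some none] fun k => some (some (b k))) := by
  classical
  set ρ := unglue τ (b i) (some (b j)) with hρ
  have hne : b i ≠ b j := h.pow_ne hn hij 0 0
  have hτ : ∀ i m, τ ((τ ^ m) (b i)) = (τ ^ (m + 1)) (b i) := fun i m => by
    rw [pow_succ', Perm.mul_apply]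
  have hlast : ∀ i, τ ((τ ^ (n i - 1)) (b i)) = b i := fun i => by
    rw [hτ, Nat.sub_add_cancel (hn i), h.period]
  have hself : ∀ i m, m + 1 < n i → (τ ^ (m + 1)) (b i) ≠ b i := fun i m hm e => by
    have := (h.eq_of_pow_eq (i := i) (j := i) (m := 0) hm (hn i) e).2
    omega
  obtain ⟨hj1, hj2⟩ := pow_succ_apply_of_chain (ρ := ρ) (τ := τ) (g := fun x => some (some x))
    (p := some none) (q := b j) (r := none) (hn j) (unglue_some_none _ _ _)
    (fun m hm => by
      rw [← hτ]
      apply unglue_of_ne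
      · rw [hτ]; exact h.pow_ne hn hij.symm (m + 1) 0
      · rw [hτ, ne_eq, Option.some_inj]; exact hself j m hm)
    (by simp [hρ, unglue_some_some, hlast, hne.symm])
  obtain ⟨hi1, hi2⟩ := pow_succ_apply_of_chain (ρ := ρ) (τ := τ) (g := fun x => some (some x))
    (p := none) (q := b i) (r := some none) (hn i) (by simp [hρ, unglue_none, hne])
    (fun m hm => by
      rw [← hτ]
      apply unglue_of_ne
      · rw [hτ]; exact hself i m hm
      · rw [hτ, ne_eq, Option.some_inj]; exact h.pow_ne hn hij (m + 1) 0)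
    (by simp [hρ, unglue_some_some, hlast])
  have hk : ∀ k, p k → ∀ m, (ρ ^ m) (some (some (b k))) = some (some ((τ ^ m) (b k))) :=
    fun k hk => h.unglue_pow_of_ne hn ((hp k).1 hk).1 ((hp k).1 hk).2
      (fun c e => ⟨0, (Option.some_inj.1 e).symm⟩)
  refine ⟨?_, ?_, ?_⟩
  · rintro (_ | _ | x)
    · exact ⟨Sum.inl 0, n j + 1, by simp [hm], hj2⟩
    · exact ⟨Sum.inl 0, 0, by simp [hm], rfl⟩
    · obtain ⟨k, l, hl, rfl⟩ := h.exists_eq x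
      by_cases e : k = i
      · subst e
        refine ⟨Sum.inl 0, (l + 1) + (n j + 1), by simp [hm]; omega, ?_⟩
        rw [pow_add, Perm.mul_apply]
        simp only [Sum.elim_inl, Matrix.cons_val_zero]
        rw [hj2, hi1 l hl]
      by_cases e' : k = j
      · subst e'
        exact ⟨Sum.inl 0, l + 1, by simp [hm]; omega, hj1 l hl⟩
      · exact ⟨Sum.inr ⟨k, (hp k).2 ⟨e, e'⟩⟩, l, hl, hk k ((hp k).2 ⟨e, e'⟩) l⟩
  · have e : ∑ k, n k = n i + n j + ∑ k : {k // p k}, n k := by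
      rw [← Finset.sum_add_sum_compl {i, j} n, Finset.sum_pair hij]
      congr 1
      refine Finset.sum_subtype _ (fun k => ?_) n
      rw [hp]
      simp
    rw [Finite.card_option, Finite.card_option, h.card, e]
    simp [hm]
    ring
  · rintro (u | ⟨k, hk'⟩)
    · have e : m = (n i + 1) + (n j + 1) := by omega
      simp only [Sum.elim_inl, Matrix.cons_val_fin_one]
      rw [e, pow_add, Perm.mul_apply, hj2, hi2]
    · simp only [Sum.elim_inr]
      rw [hk k hk', h.period]

/-- The `i`-th cycle is cut into two arcs: `none` closes up the first `k` points from `b i`, and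
`some none` the remaining `n i - k`. For `k = n i` the second arc is empty and `some none` is a
fixed point, which is the case `y = none`. -/
theorem IsCycleBase.split [Fintype ι] [DecidableEq ι] [DecidableEq X] [Finite X] {τ : Perm X}
    {n : ι → ℕ} {b : ι → X} (h : IsCycleBase τ n b) (hn : ∀ i, 0 < n i) (i : ι) {k : ℕ}
    (hk : k ≤ n i) :
    IsCycleBase (unglue τ (b i) (if k = n i then none else some ((τ ^ k) (b i))))
      (Sum.elim ![n i + 2 - (k + 1), k + 1] fun j : {j // j ≠ i} => n j)
      (Sum.elim ![some none, none] fun j => some (some (b j))) := by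
  set y := if k = n i then none else some ((τ ^ k) (b i)) with hy
  set ρ := unglue τ (b i) y with hρ
  have hτ : ∀ i m, τ ((τ ^ m) (b i)) = (τ ^ (m + 1)) (b i) := fun i m => by
    rw [pow_succ', Perm.mul_apply]
  have hlast : ∀ i, τ ((τ ^ (n i - 1)) (b i)) = b i := fun i => by
    rw [hτ, Nat.sub_add_cancel (hn i), h.period]
  have hinj : ∀ l m, l < n i → m < n i → l ≠ m → (τ ^ l) (b i) ≠ (τ ^ m) (b i) :=
    fun l m hl hm hlm e => hlm (h.eq_of_pow_eq hl hm e).2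
  have hself : ∀ m, m + 1 < n i → (τ ^ (m + 1)) (b i) ≠ b i := fun m hm =>
    hinj (m + 1) 0 hm (hn i) (by omega)
  have hny : ∀ m, m < n i → m ≠ k → some ((τ ^ m) (b i)) ≠ y := by
    intro m hm hmk
    rw [hy]
    split_ifs with e
    · simp
    · rw [ne_eq, Option.some_inj]
      exact hinj m k hm (by omega) hmk
  have ht : (∀ m < k, (ρ ^ (m + 1)) none = some (some ((τ ^ m) (b i)))) ∧
      (ρ ^ (k + 1)) none = none := by
    rcases Nat.eq_zero_or_pos k with rfl | hk0
    · refine ⟨fun m hm => absurd hm (by omega), ?_⟩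
      simp [hρ, hy, unglue_none, (hn i).ne]
    · refine pow_succ_apply_of_chain (ρ := ρ) (τ := τ) (g := fun x => some (some x)) hk0 ?_ ?_ ?_
      · exact (unglue_none _ _ _).trans (if_neg (hny 0 (hn i) hk0.ne))
      · intro m hm
        rw [← hτ]
        apply unglue_of_ne
        · rw [hτ]; exact hself m (by omega)
        · rw [hτ]; exact hny (m + 1) (by omega) (by omega)
      · have e : τ ((τ ^ (k - 1)) (b i)) = (τ ^ k) (b i) := by
          rw [hτ, Nat.sub_add_cancel hk0]
        rw [hρ, unglue_some_some, e, if_pos]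
        rw [hy]
        by_cases e : k = n i
        · rw [if_pos e, e, if_pos (h.period i)]
        · rw [if_neg e, if_neg]
          exact hinj k 0 (by omega) (hn i) hk0.ne'
  have hs : (∀ m < n i - k, (ρ ^ (m + 1)) (some none) = some (some ((τ ^ (m + k)) (b i)))) ∧
      (ρ ^ (n i - k + 1)) (some none) = some none := by
    rcases hk.eq_or_lt with e | hlt
    · refine ⟨fun m hm => absurd hm (by omega), ?_⟩
      simp [hρ, unglue_some_none, hy, e]
    · have := pow_succ_apply_of_chain (ρ := ρ) (τ := τ) (g := fun x => some (some x))
        (p := some none) (q := (τ ^ k) (b i)) (r := some none) (M := n i - k) (by omega) ?_ ?_ ?_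
      · simpa only [pow_add, Perm.mul_apply] using this
      · rw [hρ, unglue_some_none, hy, if_neg hlt.ne]
      · intro m hm
        simp only [← Perm.mul_apply, ← pow_add]
        rw [show m + 1 + k = (m + k) + 1 by ring, ← hτ]
        apply unglue_of_ne
        · rw [hτ]; exact hself _ (by omega)
        · rw [hτ]; exact hny _ (by omega) (by omega)
      · simp only [← Perm.mul_apply, ← pow_add]
        rw [show n i - k - 1 + k = n i - 1 by omega, hρ, unglue_some_some, hlast, if_pos rfl,
          if_neg]
        rw [hy, if_neg hlt.ne]
        simp
  have hj : ∀ j, j ≠ i → ∀ m, (ρ ^ m) (some (some (b j))) = some (some ((τ ^ m) (b j))) := by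
    intro j hj
    refine h.unglue_pow_of_ne hn hj hj (fun c e => ⟨k, ?_⟩)
    rw [hy] at e
    split_ifs at e
    exact (Option.some_inj.1 e).symm
  refine ⟨?_, ?_, ?_⟩
  · rintro (_ | _ | x)
    · exact ⟨Sum.inl 1, 0, by simp, rfl⟩
    · exact ⟨Sum.inl 0, 0, by simp; omega, rfl⟩
    · obtain ⟨j, l, hl, rfl⟩ := h.exists_eq x
      by_cases e : j = i
      · subst e
        by_cases hlk : l < k
        · exact ⟨Sum.inl 1, l + 1, by simp; omega, ht.1 l hlk⟩
        · refine ⟨Sum.inl 0, l - k + 1, by simp; omega, ?_⟩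
          have := hs.1 (l - k) (by omega)
          rwa [Nat.sub_add_cancel (by omega)] at this
      · exact ⟨Sum.inr ⟨j, e⟩, l, hl, hj j e l⟩
  · have e : ∑ j, n j = n i + ∑ j : {j // j ≠ i}, n j := by
      rw [← Finset.sum_add_sum_compl {i} n, Finset.sum_singleton]
      congr 1
      exact Finset.sum_subtype _ (fun k => by simp) n
    rw [Finite.card_option, Finite.card_option, h.card, e]
    simp [Fin.sum_univ_two]
    omega
  · rintro (u | ⟨j, hj'⟩)
    · match u with
      | 0 =>
        simp only [Sum.elim_inl, Matrix.cons_val_zero]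
        rw [show n i + 2 - (k + 1) = n i - k + 1 by omega, hs.2]
      | 1 => exact ht.2
    · simp only [Sum.elim_inr]
      rw [hj j hj', h.period]

end Cycles

/-! ### The recursion for gluings of a numbered polygon -/

section Recursion

open Equiv

variable {N : ℕ} {ι : Type} [Fintype ι] {n : ι → ℕ}

theorem card_gluings_merge [DecidableEq ι] (hn : ∀ i, 0 < n i) {i j : ι} (hij : i ≠ j) (l : Fin (n i))
    (l' : Fin (n j)) {p : ι → Prop} [Fintype {k // p k}] (hp : ∀ k, p k ↔ k ≠ i ∧ k ≠ j) {m : ℕ}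
    (hm : m = n i + n j + 2) :
    Nat.card (Gluings N (unglue (blockRotate n) ⟨i, l⟩ (some ⟨j, l'⟩))) =
      Nat.card (Gluings N (blockRotate (Sum.elim ![m] fun k : {k // p k} => n k))) := by
  -- The base points of the two cycles are moved to the chosen letters.
  have h := isCycleBase_blockRotate n
    (Function.update (Function.update (fun k => ⟨0, hn k⟩) i l) j l')
  have := (h.merge hn hij hp hm).card_gluings (N := N)
  simpa [Function.update_of_ne hij] using this

theorem sum_card_gluings_split [DecidableEq ι] (hn : ∀ i, 0 < n i) (i : ι) (l : Fin (n i)) :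
    Nat.card (Gluings N (unglue (blockRotate n) ⟨i, l⟩ none)) +
      ∑ l' : Fin (n i), Nat.card (Gluings N (unglue (blockRotate n) ⟨i, l⟩ (some ⟨i, l'⟩))) =
    ∑ x ∈ Finset.Icc 1 (n i + 1), Nat.card (Gluings N (blockRotate
      (Sum.elim ![n i + 2 - x, x] fun k : {k // k ≠ i} => n k))) := by
  have h := isCycleBase_blockRotate n (Function.update (fun k => ⟨0, hn k⟩) i l)
  have hs : ∀ k ≤ n i, _ := fun k hk => (h.split hn i hk).card_gluings (N := N)
  simp only [Function.update_self, blockRotate_pow_apply] at hs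
  have hbij : Function.Bijective fun k : Fin (n i) => (finRotate (n i) ^ (k : ℕ)) l := by
    refine Function.Surjective.bijective_of_finite fun l' => ?_
    obtain ⟨k, hk, e⟩ := exists_finRotate_pow l l'
    exact ⟨⟨k, hk⟩, e⟩
  -- Here `x = k + 1`, where `k` is the number of rotation steps from `l` to `l'`; the top term `k =
  -- n i` accounts for `y = none`.
  have hI : Finset.Icc 1 (n i + 1) = Finset.Ico (0 + 1) (n i + 1 + 1) := by
    ext x
    simp
  rw [hI, ← Finset.sum_Ico_add', ← Finset.range_eq_Ico]
  rw [Finset.sum_range_succ, ← hs (n i) le_rfl, if_pos rfl, add_comm]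
  congr 1
  rw [← Function.Bijective.sum_comp hbij
    (fun l' => Nat.card (Gluings N (unglue (blockRotate n) ⟨i, l⟩ (some ⟨i, l'⟩)))),
    ← Fin.sum_univ_eq_sum_range (fun x => Nat.card (Gluings N (blockRotate
      (Sum.elim ![n i + 2 - (x + 1), x + 1] fun k : {k // k ≠ i} => n k))))]
  refine Finset.sum_congr rfl fun k _ => ?_
  rw [← hs k k.2.le, if_neg k.2.ne]

theorem card_gluings_blockRotate_mul [LinearOrder ι] (hn : ∀ i, 0 < n i) :
    ((N : ℤ) - (∑ i, n i : ℕ)) * Nat.card (Gluings N (blockRotate n)) =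
      2 * (∑ i, ∑ j ∈ Finset.univ.filter (fun j => i < j), (n i : ℤ) * n j *
        Nat.card (Gluings N (blockRotate
          (Sum.elim ![n i + n j + 2] fun k : {k // k ≠ i ∧ k ≠ j} => n k)))) +
      ∑ i, (n i : ℤ) * ∑ x ∈ Finset.Icc 1 (n i + 1), (Nat.card (Gluings N (blockRotate
        (Sum.elim ![n i + 2 - x, x] fun k : {k // k ≠ i} => n k))) : ℤ) := by
  classical
  set M : ι → ι → ℤ := fun i j => (n i : ℤ) * n j * Nat.card (Gluings N (blockRotate
    (Sum.elim ![n i + n j + 2] fun k : {k // k ≠ i ∧ k ≠ j} => n k))) with hM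
  set D : (i j : ι) → Fin (n i) → Fin (n j) → ℤ := fun i j l l' =>
    Nat.card (Gluings N (unglue (blockRotate n) ⟨i, l⟩ (some ⟨j, l'⟩))) with hD
  -- Both orders of the two boundaries yield the same merged cycle type, hence the factor 2.
  have hlt : ∀ i j, i < j → (∑ l, ∑ l', D i j l l' = M i j) ∧ (∑ l, ∑ l', D j i l l' = M i j) := by
    intro i j hij
    constructor
    · rw [Finset.sum_congr rfl fun l _ => Finset.sum_congr rfl fun l' _ =>
        congrArg (Nat.cast : ℕ → ℤ) (card_gluings_merge (N := N) hn hij.ne l l'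
          (p := fun k => k ≠ i ∧ k ≠ j) (fun _ => Iff.rfl) rfl)]
      simp [hM]
      ring
    · rw [Finset.sum_congr rfl fun l _ => Finset.sum_congr rfl fun l' _ =>
        congrArg (Nat.cast : ℕ → ℤ) (card_gluings_merge (N := N) hn hij.ne' l l'
          (p := fun k => k ≠ i ∧ k ≠ j) (fun _ => and_comm) (m := n i + n j + 2) (by ring))]
      simp [hM]
      ring
  have hcard : Fintype.card (Σ i, Fin (n i)) = ∑ i, n i := by simp
  have key := card_gluings_mul (N := N) (blockRotate n)
  rw [hcard] at key
  rw [key]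
  have h1 : ∀ i (l : Fin (n i)),
      ∑ y, (Nat.card (Gluings N (unglue (blockRotate n) ⟨i, l⟩ y)) : ℤ) =
        ∑ j, (if j = i then 0 else ∑ l', D i j l l') +
        ∑ x ∈ Finset.Icc 1 (n i + 1), (Nat.card (Gluings N (blockRotate
          (Sum.elim ![n i + 2 - x, x] fun k : {k // k ≠ i} => n k))) : ℤ) := by
    intro i l
    rw [Fintype.sum_option, Fintype.sum_sigma, ← Nat.cast_sum, ← sum_card_gluings_split hn i l,
      ← Finset.add_sum_erase _ _ (Finset.mem_univ i),
      ← Finset.add_sum_erase _ (fun j => if j = i then 0 else ∑ l', D i j l l')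
        (Finset.mem_univ i), if_pos rfl, zero_add,
      Finset.sum_congr rfl fun j hj => if_neg (Finset.ne_of_mem_erase hj)]
    push_cast
    ring
  rw [Fintype.sum_sigma, Finset.sum_congr rfl fun i _ => Finset.sum_congr rfl fun l _ => h1 i l]
  simp only [Finset.sum_add_distrib]
  congr 1
  · have h2 : ∀ i, ∑ l : Fin (n i), ∑ j, (if j = i then 0 else ∑ l', D i j l l') =
        ∑ j, ((if i < j then M i j else 0) + if j < i then M j i else 0) := by
      intro i
      rw [Finset.sum_comm]
      refine Finset.sum_congr rfl fun j _ => ?_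
      rcases lt_trichotomy i j with h | rfl | h
      · simp [h.ne', h, h.not_gt, (hlt i j h).1]
      · simp
      · simp [h.ne, h, h.not_gt, (hlt j i h).2]
    rw [Finset.sum_congr rfl fun i _ => h2 i]
    simp only [Finset.sum_add_distrib, Finset.sum_filter]
    rw [two_mul]
    congr 1
    rw [Finset.sum_comm]
  · simp

end Recursion

/-! ### Nonnegativity of the genus -/

section GenusBound

variable {N : ℕ} {ι : Type} [Fintype ι] {n : ι → ℕ}

theorem forall_of_finRotate (hN : 0 < N) {T : Fin N → Prop} (h0 : T ⟨0, hN⟩)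
    (hs : ∀ s, T s → T (finRotate N s)) (s : Fin N) : T s := by
  obtain ⟨k, -, rfl⟩ := exists_finRotate_pow ⟨0, hN⟩ s
  induction k with
  | zero => exact h0
  | succ k ih => rw [pow_succ', Equiv.Perm.mul_apply]; exact hs _ ih

/-- The surface has nonnegative genus. -/
theorem IsGluing.two_mul_card_le (hn : ∀ i, 0 < n i) {α : Fin N → Fin N}
    {f : (Σ i, Fin (n i)) → Fin N} (h : IsGluing (blockRotate n) α f) (hN : 0 < N) :
    2 * Fintype.card ι + ∑ i, n i ≤ N + 2 := by
  classical
  obtain ⟨k, hk⟩ := h.returns.2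
  have hc : ∀ s, (k (finRotate N s)).1 = (k (α s)).1 := by
    intro s
    have hφ : ∀ u, (k (finRotate N (α u))).1 = (k u).1 := by
      intro u
      by_cases hu : u ∈ Set.range f
      · obtain ⟨x, rfl⟩ := hu
        rw [hk.next, hk.at_range]
        rfl
      · exact congrArg Sigma.fst (hk.off_range u hu)
    rw [← hφ (α s), h.involutive]
  -- Boundaries are joined when a glued edge runs between them. Going once around the polygon shows
  -- that this graph is connected, so it has at least `L - 1` edges; distinct darts need distinct
  -- glued sides.
  let G : SimpleGraph ι := SimpleGraph.fromRel fun i j => ∃ s, (k s).1 = i ∧ (k (α s)).1 = j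
  have hadj : ∀ i j, G.Adj i j → ∃ s, (k s).1 = i ∧ (k (α s)).1 = j := by
    rintro i j ⟨-, h1 | ⟨s, h1, h2⟩⟩
    · exact h1
    · exact ⟨α s, h2, by rw [h.involutive, h1]⟩
  have hreach : ∀ s, G.Reachable (k ⟨0, hN⟩).1 (k s).1 := by
    refine forall_of_finRotate hN (.refl _) fun s hs => ?_
    rw [hc]
    by_cases e : (k s).1 = (k (α s)).1
    · rwa [← e]
    · exact hs.trans (SimpleGraph.Adj.reachable ⟨e, Or.inl ⟨s, rfl, rfl⟩⟩)
  have hreach' : ∀ i, G.Reachable (k ⟨0, hN⟩).1 i := by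
    intro i
    have := hreach (f ⟨i, 0, hn i⟩)
    rwa [hk.at_range] at this
  have hconn : G.Connected :=
    { preconnected := fun i j => (hreach' i).symm.trans (hreach' j)
      nonempty := ⟨(k ⟨0, hN⟩).1⟩ }
  have h1 := hconn.card_vert_le_card_edgeSet_add_one
  have h2 := G.dart_card_eq_twice_card_edges
  have h3 : Fintype.card G.Dart ≤ Nat.card {s // α s ≠ s} := by
    choose s hs hs' using fun d : G.Dart => hadj d.fst d.snd d.adj
    rw [← Nat.card_eq_fintype_card]
    refine Nat.card_le_card_of_injective
      (fun d => ⟨s d, fun e => d.adj.ne (by rw [← hs, ← hs', e])⟩) fun d d' e => ?_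
    have e := congrArg Subtype.val e
    dsimp only at e
    refine SimpleGraph.Dart.ext _ _ (Prod.ext ?_ ?_)
    · exact (hs d).symm.trans ((congrArg (fun s => (k s).1) e).trans (hs d'))
    · exact (hs' d).symm.trans ((congrArg (fun s => (k (α s)).1) e).trans (hs' d'))
  have h4 := h.card_glued
  rw [Nat.card_eq_fintype_card (α := Σ i, Fin (n i)),
    show Fintype.card (Σ i, Fin (n i)) = ∑ i, n i by simp] at h4
  rw [Nat.card_eq_fintype_card, Nat.card_eq_fintype_card,
    ← SimpleGraph.edgeFinset_card] at h1
  omega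

end GenusBound

/-! ### From the topological definition to return maps -/

section Produces

namespace PolygonGluing

variable {N : ℕ} {ι : Type} {n : ι → ℕ}

theorem eq_of_pair_of_side {G H : PolygonGluing N n} (h : G.pair = H.pair)
    (h' : G.side = H.side) : G = H := by
  cases G
  cases H
  subst h
  subst h'
  rfl

theorem pair_eq_iff_mem_range (G : PolygonGluing N n) (s : Fin N) :
    G.pair s = s ↔ s ∈ Set.range G.side := G.pair_eq_iff s

/-- At a glued side `CornerRel` is one step of the walk, so a property preserved by these steps in
both directions descends to vertices. -/
theorem pair_eq_iff_of_walk (G : PolygonGluing N n) {v : G.Vertex} {P : Fin N → Prop}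
    (h : ∀ s, G.pair s ≠ s → (P s ↔ P (G.walk s))) {s t : Fin N}
    (hs : Quot.mk G.CornerRel s = v) (ht : Quot.mk G.CornerRel t = v) : P s ↔ P t := by
  let Q : G.Vertex → Prop := Quot.lift P (by
    rintro c d ⟨hc, rfl⟩
    exact propext (h c hc))
  exact Iff.of_eq (congrArg Q (hs.trans ht.symm))

/-- Whether the walk ever reaches an unglued side depends only on the vertex, and a vertex that is
not interior is the start of an unglued side. -/
theorem sweeps_of_isEmpty (G : PolygonGluing N n) (h : IsEmpty G.InteriorVertex) :
    Sweeps G.walk G.side := by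
  have key : ∀ s, ∃ m, G.pair (G.walk^[m] s) = G.walk^[m] s := by
    intro s
    by_contra hs
    refine h.false ⟨Quot.mk _ s, fun t ht e => hs ?_⟩
    refine (G.pair_eq_iff_of_walk (v := Quot.mk _ s)
      (P := fun s => ∃ m, G.pair (G.walk^[m] s) = G.walk^[m] s) (fun u hu => ?_) e.symm rfl).1
      ⟨0, ht⟩
    constructor
    · rintro ⟨_ | m, hm⟩
      · exact absurd hm hu
      · exact ⟨m, hm⟩
    · rintro ⟨m, hm⟩
      exact ⟨m + 1, hm⟩
  intro T h1 h2 s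
  obtain ⟨m, hm⟩ := key s
  induction m generalizing s with
  | zero =>
    obtain ⟨b, rfl⟩ := (G.pair_eq_iff s).1 hm
    exact h1 b
  | succ m ih =>
    by_cases hs : s ∈ Set.range G.side
    · obtain ⟨b, rfl⟩ := hs
      exact h1 b
    · exact h2 s hs (ih _ hm)

theorem isEmpty_of_sweeps (G : PolygonGluing N n) (h : Sweeps G.walk G.side) :
    IsEmpty G.InteriorVertex := by
  have key : ∀ s, ∃ t, G.pair t = t ∧ Quot.mk G.CornerRel s = Quot.mk G.CornerRel t := by
    refine h _ (fun b => ⟨_, (G.pair_eq_iff_mem_range _).2 ⟨b, rfl⟩, rfl⟩) ?_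
    rintro s hs ⟨t, ht, e⟩
    exact ⟨t, ht, (Quot.sound ⟨fun hs' => hs ((G.pair_eq_iff_mem_range s).1 hs'), rfl⟩).trans e⟩
  refine ⟨fun ⟨v, hv⟩ => ?_⟩
  induction v using Quot.ind with
  | mk s =>
    obtain ⟨t, ht, e⟩ := key s
    exact hv t ht e

theorem FirstHit.eq_of_boundaryNext {G : PolygonGluing N n}
    {τ : (Σ i, Fin (n i)) → Σ i, Fin (n i)} {h : Fin N → Σ i, Fin (n i)}
    (hh : FirstHit G.walk G.side τ h) {b c : Σ i, Fin (n i)}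
    (hb : G.BoundaryNext (G.side b) (G.side c)) : τ b = c := by
  obtain ⟨m, hm, hm'⟩ := hb
  have key : ∀ j ≤ m, h (G.walk^[j + 1] (G.side b)) = τ b := by
    intro j hj
    induction j with
    | zero => exact hh.next b
    | succ j ih =>
      rw [Function.iterate_succ_apply', hh.off_range, ih (by omega)]
      rw [← pair_eq_iff_mem_range]
      exact hm' (j + 1) (by omega) hj
  rw [← key m le_rfl, hm, hh.at_range]

theorem boundaryNext_of_returns {G : PolygonGluing N n}
    {τ : (Σ i, Fin (n i)) → Σ i, Fin (n i)} (h : Returns G.walk G.side τ)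
    (b : Σ i, Fin (n i)) : G.BoundaryNext (G.side b) (G.side (τ b)) := by
  obtain ⟨hs, h, hh⟩ := h
  have key : ∀ s, ∃ m, G.walk^[m] s = G.side (h s) ∧
      ∀ j < m, G.pair (G.walk^[j] s) ≠ G.walk^[j] s := by
    refine hs _ (fun b => ⟨0, by rw [hh.at_range]; rfl, by simp⟩) ?_
    rintro s hn ⟨m, hm, hm'⟩
    refine ⟨m + 1, by rw [← hh.off_range s hn]; exact hm, ?_⟩
    rintro (_ | j) hj
    · exact fun e => hn ((G.pair_eq_iff_mem_range s).1 e)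
    · exact hm' j (by omega)
  obtain ⟨m, hm, hm'⟩ := key (G.walk (G.side b))
  rw [hh.next] at hm
  refine ⟨m, hm, ?_⟩
  rintro (_ | j) h1 h2
  · omega
  · exact hm' j (by omega)

theorem isGluing_iff [Finite ι] (G : PolygonGluing N n) :
    IsGluing (blockRotate n) G.pair G.side ↔
      (∀ (i : ι) (k : Fin (n i)),
        G.BoundaryNext (G.side ⟨i, k⟩) (G.side ⟨i, finRotate (n i) k⟩)) ∧
      IsEmpty G.InteriorVertex := by
  constructor
  · intro h
    exact ⟨fun i k => boundaryNext_of_returns h.returns ⟨i, k⟩, G.isEmpty_of_sweeps h.returns.1⟩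
  · rintro ⟨h1, h2⟩
    have hs := G.sweeps_of_isEmpty h2
    obtain ⟨τ, h, hh⟩ := hs.exists_firstHit G.side_injective
    refine ⟨G.pair_pair, G.side_injective, G.pair_eq_iff_mem_range, hs, h, ?_⟩
    have : τ = blockRotate n := by
      funext ⟨i, k⟩
      exact FirstHit.eq_of_boundaryNext hh (h1 i k)
    exact this ▸ hh

/-- Each vertex is the start of exactly one unglued side, the one where the walk around it stops. -/
theorem card_vertex [Finite ι] (G : PolygonGluing N n)
    (h : IsGluing (blockRotate n) G.pair G.side) :
    Nat.card G.Vertex = Nat.card (Σ i, Fin (n i)) := by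
  obtain ⟨hs, h, hh⟩ := h.returns
  let H : G.Vertex → Σ i, Fin (n i) := Quot.lift h (by
    rintro c d ⟨hc, rfl⟩
    exact (hh.off_range c fun e => hc ((G.pair_eq_iff_mem_range c).2 e)).symm)
  have key : ∀ s, Quot.mk G.CornerRel s = Quot.mk G.CornerRel (G.side (h s)) := by
    refine hs _ (fun b => by rw [hh.at_range]) fun s hn e => ?_
    have e' := hh.off_range s hn
    rw [e'] at e
    exact (Quot.sound ⟨fun hs' => hn ((G.pair_eq_iff_mem_range s).1 hs'), rfl⟩).trans e
  refine Nat.card_congr ⟨H, fun b => Quot.mk _ (G.side b), fun v => ?_, fun b => hh.at_range b⟩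
  induction v using Quot.ind with
  | mk s => exact (key s).symm

theorem edge_mk_eq_iff (G : PolygonGluing N n) (s t : Fin N) :
    (Quot.mk _ t : G.Edge) = Quot.mk _ s ↔ t = s ∨ t = G.pair s := by
  let q : G.Edge → Sym2 (Fin N) := Quot.lift (fun s => s(s, G.pair s)) (by
    rintro s t rfl
    rw [G.pair_pair, Sym2.eq_swap])
  constructor
  · intro e
    have e : s(t, G.pair t) = s(s, G.pair s) := congrArg q e
    rw [Sym2.eq_iff] at e
    tauto
  · rintro (rfl | rfl)
    · rfl
    · exact (Quot.sound (r := fun s t => t = G.pair s) rfl).symm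

/-- Counting all sides and the unglued ones once more, every edge is counted twice. -/
theorem two_mul_card_edge [Finite ι] (G : PolygonGluing N n) :
    2 * Nat.card G.Edge = N + Nat.card (Σ i, Fin (n i)) := by
  classical
  have : Fintype ι := Fintype.ofFinite ι
  have : Finite G.Edge := Quot.finite _
  have : Fintype G.Edge := Fintype.ofFinite _
  let q : Fin N → G.Edge := Quot.mk _
  have h1 : N = ∑ e, (Finset.univ.filter fun s => q s = e).card := by
    conv_lhs => rw [← Fintype.card_fin N, ← Finset.card_univ]
    exact Finset.card_eq_sum_card_fiberwise fun s _ => Finset.mem_coe.2 (Finset.mem_univ _)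
  have h2 : Nat.card (Σ i, Fin (n i)) =
      ∑ e, ((Finset.univ.filter fun s => G.pair s = s).filter fun s => q s = e).card := by
    refine Eq.trans ?_
      (Finset.card_eq_sum_card_fiberwise fun s _ => Finset.mem_coe.2 (Finset.mem_univ _))
    rw [← Fintype.card_subtype, ← Nat.card_eq_fintype_card]
    exact Nat.card_congr ((Equiv.ofInjective _ G.side_injective).trans
      (Equiv.subtypeEquivRight fun s => (G.pair_eq_iff_mem_range s).symm))
  have h3 := congrArg₂ (· + ·) h1 h2
  rw [h3, ← Finset.sum_add_distrib, Finset.sum_congr rfl (g := fun _ => 2)]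
  · simp [mul_comm]
  · intro e _
    induction e using Quot.ind with
    | mk s =>
      have e1 : (Finset.univ.filter fun t => q t = Quot.mk _ s) = {s, G.pair s} := by
        ext t
        simp only [Finset.mem_filter, Finset.mem_univ, true_and, Finset.mem_insert,
          Finset.mem_singleton]
        exact G.edge_mk_eq_iff s t
      rw [Finset.filter_comm, e1]
      by_cases hs : G.pair s = s
      · simp [hs, Finset.filter_singleton]
      · rw [Finset.card_pair (Ne.symm hs), Finset.filter_false_of_mem]
        · rfl
        · simp only [Finset.mem_insert, Finset.mem_singleton]
          rintro t (rfl | rfl)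
          · exact hs
          · rw [G.pair_pair]
            exact Ne.symm hs

theorem produces_iff [Fintype ι] (hn : ∀ i, 0 < n i) (G : PolygonGluing N n) (g : ℤ) :
    G.Produces g ↔ IsGluing (blockRotate n) G.pair G.side ∧
      (N : ℤ) + 2 = (∑ i, n i : ℕ) + 2 * Fintype.card ι + 4 * g := by
  have h0 : Nat.card {i : ι // n i = 0} = 0 := by
    have : IsEmpty {i : ι // n i = 0} := ⟨fun i => (hn i).ne' i.2⟩
    exact Nat.card_of_isEmpty
  have hL : Nat.card {i : ι // 0 < n i} = Fintype.card ι := by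
    rw [← Nat.card_eq_fintype_card]
    exact Nat.card_congr (Equiv.subtypeUnivEquiv hn)
  have hX : Nat.card (Σ i, Fin (n i)) = ∑ i, n i := by simp
  have hfin : Finite G.InteriorVertex := by
    have : Finite G.Vertex := Quot.finite _
    exact Subtype.finite
  have hE := G.two_mul_card_edge
  rw [hX] at hE
  constructor
  · rintro ⟨h1, h2, h3⟩
    rw [h0] at h2
    have h := G.isGluing_iff.2 ⟨h1, (Finite.card_eq_zero_iff).1 h2⟩
    refine ⟨h, ?_⟩
    rw [eulerChar, G.card_vertex h, hX, hL] at h3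
    omega
  · rintro ⟨h, h3⟩
    obtain ⟨h1, h2⟩ := G.isGluing_iff.1 h
    refine ⟨h1, by rw [h0]; exact Nat.card_of_isEmpty, ?_⟩
    rw [eulerChar, G.card_vertex h, hX, hL]
    omega

theorem rotEquiv_iff (G H : PolygonGluing N n) :
    G.RotEquiv H ↔ ∃ c ∈ Subgroup.zpowers (finRotate N),
      (∀ s, H.pair (c s) = c (G.pair s)) ∧ ∀ b, H.side b = c (G.side b) := by
  simp only [← mem_powers_iff_mem_zpowers, Submonoid.mem_powers_iff, RotEquiv,
    Equiv.Perm.iterate_eq_pow]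
  simp

theorem rotEquiv_equivalence :
    Equivalence (RotEquiv : PolygonGluing N n → PolygonGluing N n → Prop) where
  refl G := (rotEquiv_iff _ _).2 ⟨1, one_mem _, by simp, by simp⟩
  symm {G H} h := by
    obtain ⟨c, hc, h1, h2⟩ := (rotEquiv_iff _ _).1 h
    refine (rotEquiv_iff _ _).2 ⟨c⁻¹, inv_mem hc, fun s => ?_, fun b => ?_⟩
    · rw [Equiv.Perm.eq_inv_iff_eq, ← h1]; simp
    · rw [Equiv.Perm.eq_inv_iff_eq, h2]
  trans {G H K} h h' := by
    obtain ⟨c, hc, h1, h2⟩ := (rotEquiv_iff _ _).1 h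
    obtain ⟨d, hd, h3, h4⟩ := (rotEquiv_iff _ _).1 h'
    exact (rotEquiv_iff _ _).2 ⟨d * c, mul_mem hd hc, fun s => by simp [h1, h3],
      fun b => by simp [h2, h4]⟩

end PolygonGluing

theorem zpowers_finRotate_comm {N : ℕ} {c : Equiv.Perm (Fin N)}
    (hc : c ∈ Subgroup.zpowers (finRotate N)) (k : ℕ) (s : Fin N) :
    (finRotate N ^ k) (c s) = c ((finRotate N ^ k) s) := by
  obtain ⟨m, rfl⟩ := hc
  have : Commute (finRotate N ^ k) (finRotate N ^ m) :=
    ((Commute.refl (finRotate N)).pow_left k).zpow_right m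
  exact congrArg (fun p : Equiv.Perm (Fin N) => p s) this

theorem eq_one_of_zpowers_finRotate {N : ℕ} {c : Equiv.Perm (Fin N)}
    (hc : c ∈ Subgroup.zpowers (finRotate N)) {s : Fin N} (hs : c s = s) : c = 1 := by
  ext t
  obtain ⟨k, -, rfl⟩ := exists_finRotate_pow s t
  rw [← zpowers_finRotate_comm hc, hs]
  rfl

theorem IsGluing.rotate {N : ℕ} {X : Type} {τ : X → X} {α : Fin N → Fin N} {f : X → Fin N}
    (h : IsGluing τ α f) {c : Equiv.Perm (Fin N)} (hc : c ∈ Subgroup.zpowers (finRotate N)) :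
    IsGluing τ (fun s => c (α (c.symm s))) (c ∘ f) where
  involutive s := by simp [h.involutive (c.symm s)]
  injective := c.injective.comp h.injective
  fixed_iff s := by
    obtain ⟨s, rfl⟩ := c.surjective s
    rw [Equiv.symm_apply_apply, c.apply_eq_iff_eq, h.fixed_iff]
    simp [Set.mem_range]
  returns := h.returns.conj c fun s => by
    have := zpowers_finRotate_comm hc 1 (α s)
    simpa using this

/-! ### Rotation classes -/

section ClassCount

variable {N : ℕ} {ι : Type} [Fintype ι] {n : ι → ℕ}

/-- The gluing with given pairing and labels. -/
def IsGluing.toPolygonGluing {α : Fin N → Fin N} {f : (Σ i, Fin (n i)) → Fin N}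
    (h : IsGluing (blockRotate n) α f) : PolygonGluing N n where
  pair := α
  pair_pair := h.involutive
  side := f
  side_injective := h.injective
  pair_eq_iff := h.fixed_iff

theorem card_produces (hn : ∀ i, 0 < n i) {g : ℤ}
    (hN : (N : ℤ) + 2 = (∑ i, n i : ℕ) + 2 * Fintype.card ι + 4 * g) :
    Nat.card {G : PolygonGluing N n // G.Produces g} = Nat.card (Gluings N (blockRotate n)) :=
  Nat.card_congr
    ⟨fun G => ⟨(G.1.pair, G.1.side), ((G.1.produces_iff hn g).1 G.2).1⟩,
      fun q => ⟨q.2.toPolygonGluing, (PolygonGluing.produces_iff hn _ g).2 ⟨q.2, hN⟩⟩,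
      fun _ => rfl, fun _ => rfl⟩

/-- A gluing is determined by its class and the position of one fixed letter, and every position
occurs, since a rotation that fixes a side is trivial and rotations are transitive on sides. -/
theorem mul_card_gluingClass (hn : ∀ i, 0 < n i) [Nonempty ι] (g : ℤ) :
    N * Nat.card (GluingClass g n N) = Nat.card {G : PolygonGluing N n // G.Produces g} := by
  obtain ⟨i⟩ := ‹Nonempty ι›
  let b : Σ i, Fin (n i) := ⟨i, 0, hn i⟩
  let F : {G : PolygonGluing N n // G.Produces g} → Fin N × GluingClass g n N :=
    fun G => (G.1.side b, Quot.mk _ G)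
  have hE : Equivalence (fun G H : {G : PolygonGluing N n // G.Produces g} => G.1.RotEquiv H.1) :=
    PolygonGluing.rotEquiv_equivalence.comap Subtype.val
  have hF : Function.Bijective F := by
    constructor
    · intro G H e
      obtain ⟨e1, e2⟩ := Prod.mk.inj e
      obtain ⟨c, hc, h1, h2⟩ := (PolygonGluing.rotEquiv_iff _ _).1 (hE.quot_mk_eq_iff _ _ |>.1 e2)
      have := eq_one_of_zpowers_finRotate hc (s := G.1.side b) (by rw [← h2, e1])
      subst this
      exact Subtype.ext (PolygonGluing.eq_of_pair_of_side (funext fun s => (h1 s).symm)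
        (funext fun b => (h2 b).symm))
    · rintro ⟨s, K⟩
      induction K using Quot.ind with
      | mk G =>
        obtain ⟨k, -, hk⟩ := exists_finRotate_pow (G.1.side b) s
        have hc : finRotate N ^ k ∈ Subgroup.zpowers (finRotate N) :=
          pow_mem (Subgroup.mem_zpowers _) k
        obtain ⟨h, hN⟩ := (G.1.produces_iff hn g).1 G.2
        refine ⟨⟨(h.rotate hc).toPolygonGluing,
          (PolygonGluing.produces_iff hn _ g).2 ⟨h.rotate hc, hN⟩⟩, Prod.ext hk ?_⟩
        refine (hE.quot_mk_eq_iff _ _).2 (hE.symm ((PolygonGluing.rotEquiv_iff _ _).2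
          ⟨_, hc, fun s => ?_, fun b => rfl⟩))
        simp [IsGluing.toPolygonGluing]
  rw [Nat.card_eq_of_bijective F hF, Nat.card_prod, Nat.card_fin]

theorem mul_gluingCount (hn : ∀ i, 0 < n i) [Nonempty ι] {g : ℤ} (hg : 0 ≤ g) (hN0 : 0 < N)
    (hN : (N : ℤ) + 2 = (∑ i, n i : ℕ) + 2 * Fintype.card ι + 4 * g) :
    N * gluingCount g n = Nat.card (Gluings N (blockRotate n)) := by
  rw [← card_produces hn hN, ← mul_card_gluingClass hn g, gluingCount, if_neg hg.not_gt]
  congr 1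
  have hM : ∀ M : {M : ℕ // 0 < M}, M.1 ≠ N → IsEmpty (GluingClass g n M) := by
    refine fun M hM => ⟨fun K => ?_⟩
    induction K using Quot.ind with
    | mk G =>
      have := ((G.1.produces_iff hn g).1 G.2).2
      omega
  have : Function.Bijective fun K : GluingClass g n N =>
      (⟨⟨N, hN0⟩, K⟩ : Σ M : {M : ℕ // 0 < M}, GluingClass g n M) := by
    refine ⟨fun K K' e => by simpa using e, ?_⟩
    rintro ⟨⟨M, hM0⟩, K⟩
    by_cases e : M = N
    · subst e
      exact ⟨K, rfl⟩
    · exact ((hM ⟨M, hM0⟩ e).false K).elim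
  exact (Nat.card_eq_of_bijective _ this).symm

end ClassCount

end Produces

/-! ### The initial condition and the lemma -/

section Main

/-- No side is left to glue, so the letters are read around the polygon and the position of one of
them determines the rest. -/
theorem card_gluings_fin {m : ℕ} (hm : 0 < m) :
    Nat.card (Gluings m (blockRotate ![m])) = m := by
  let b : Σ i : Fin 1, Fin (![m] i) := ⟨0, ⟨0, hm⟩⟩
  have hb : ∀ x, ∃ k : ℕ, (blockRotate ![m] ^ k) b = x := by
    rintro ⟨i, l⟩
    obtain rfl : i = 0 := Subsingleton.elim _ _
    obtain ⟨k, -, hk⟩ := exists_finRotate_pow ⟨0, hm⟩ l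
    exact ⟨k, (blockRotate_pow_apply _ _ _ _).trans (congrArg (Sigma.mk 0) hk)⟩
  have hcard : Nat.card (Σ i : Fin 1, Fin (![m] i)) = m := by simp
  have hstruct : ∀ q : Gluings m (blockRotate ![m]), q.1.1 = id ∧
      ∀ k : ℕ, q.1.2 ((blockRotate ![m] ^ k) b) = (finRotate m ^ k) (q.1.2 b) := by
    rintro ⟨⟨α, f⟩, h⟩
    have hsurj : Function.Surjective f :=
      (h.injective.bijective_of_nat_card_le (by rw [hcard, Nat.card_fin])).2
    have hα : α = id := funext fun s => (h.fixed_iff s).2 (hsurj s)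
    refine ⟨hα, fun k => ?_⟩
    subst hα
    obtain ⟨-, k', hk⟩ := h.returns
    dsimp only
    induction k with
    | zero => rfl
    | succ k ih =>
      rw [pow_succ', pow_succ', Equiv.Perm.mul_apply, Equiv.Perm.mul_apply, ← ih, ← hk.next]
      obtain ⟨x, hx⟩ := hsurj (finRotate m (f ((blockRotate ![m] ^ k) b)))
      simp only [id]
      rw [← hx, hk.at_range]
  have hF : Function.Bijective fun q : Gluings m (blockRotate ![m]) => q.1.2 b := by
    constructor
    · intro q q' e
      refine Subtype.ext (Prod.ext ((hstruct q).1.trans (hstruct q').1.symm) (funext fun x => ?_))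
      obtain ⟨k, rfl⟩ := hb x
      rw [(hstruct q).2, (hstruct q').2]
      exact congrArg _ e
    · intro s
      obtain ⟨r, -, hr⟩ := exists_finRotate_pow (⟨0, hm⟩ : Fin m) s
      let e : (Σ i : Fin 1, Fin (![m] i)) ≃ Fin m := Equiv.uniqueSigma fun i => Fin (![m] i)
      let f := e.trans (finRotate m ^ r)
      have hf : ∀ x, finRotate m (f x) = f (blockRotate ![m] x) := by
        rintro ⟨i, l⟩
        obtain rfl : i = 0 := Subsingleton.elim _ _
        change (finRotate m * finRotate m ^ r) l = (finRotate m ^ r * finRotate m) l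
        rw [← pow_succ', ← pow_succ]
      exact ⟨⟨(id, f), fun _ => rfl, f.injective, fun s => by simp,
        fun T h1 _ s => by simpa using h1 (f.symm s), f.symm, fun x => by simp,
        fun s hs => absurd (f.surjective s) hs, fun x => by simp [hf]⟩, hr⟩
  rw [Nat.card_eq_of_bijective _ hF, Nat.card_fin]

theorem gluingCount_eq_zero_of_isEmpty {ι : Type} [Fintype ι] [IsEmpty ι] (g : ℤ) (n : ι → ℕ) :
    gluingCount g n = 0 := by
  rw [gluingCount]
  split_ifs
  · rfl
  have : IsEmpty (Σ N : {N : ℕ // 0 < N}, GluingClass g n N) := by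
    refine ⟨fun ⟨⟨N, hN⟩, K⟩ => ?_⟩
    induction K using Quot.ind with
    | mk G =>
      obtain ⟨h, -⟩ := (G.1.produces_iff isEmptyElim g).1 G.2
      exact h.returns.1 (fun _ => False) (fun x => isEmptyElim x.1) (fun _ _ => id) ⟨0, hN⟩
  exact Nat.card_of_isEmpty

theorem lemmaI :
    (∀ (g L : ℕ) (n : Fin L → ℕ), (∀ i, 0 < n i) →
      ((L : ℚ) + 2 * (g : ℚ) - 1) * (gluingCount (g : ℤ) n : ℚ) =
        (∑ i : Fin L, ∑ j ∈ Finset.univ.filter (fun j : Fin L => i < j),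
          (n i : ℚ) * (n j : ℚ) *
            (gluingCount (g : ℤ)
              (Sum.elim ![n i + n j + 2] (fun k : {k : Fin L // k ≠ i ∧ k ≠ j} => n k)) : ℚ)) +
        1 / 2 * ∑ i : Fin L, (n i : ℚ) * ∑ x ∈ Finset.Icc 1 (n i + 1),
            (gluingCount ((g : ℤ) - 1)
              (Sum.elim ![n i + 2 - x, x] (fun k : {k : Fin L // k ≠ i} => n k)) : ℚ)) ∧
    (∀ m : ℕ, 0 < m → gluingCount 0 ![m] = 1) := by
  constructor
  · intro g L n hn
    rcases Nat.eq_zero_or_pos L with rfl | hL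
    · simp [gluingCount_eq_zero_of_isEmpty]
    have : Nonempty (Fin L) := ⟨⟨0, hL⟩⟩
    -- The side count forced by the Euler characteristic; it is the same for every term of the
    -- recursion.
    obtain ⟨N, hN⟩ : ∃ N, N + 2 = (∑ i, n i) + 2 * L + 4 * g := ⟨_, Nat.sub_add_cancel (by omega)⟩
    have hsum : 0 < ∑ i, n i := Finset.sum_pos (fun i _ => hn i) Finset.univ_nonempty
    have hN0 : 0 < N := by omega
    have hfull : (N : ℤ) * gluingCount (g : ℤ) n = Nat.card (Gluings N (blockRotate n)) := by
      rw [← mul_gluingCount hn (Int.natCast_nonneg g) hN0 (by rw [Fintype.card_fin]; omega)]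
      push_cast
      rfl
    have hmerge : ∀ i j : Fin L, i < j → (N : ℤ) * gluingCount (g : ℤ)
        (Sum.elim ![n i + n j + 2] (fun k : {k : Fin L // k ≠ i ∧ k ≠ j} => n k)) =
        Nat.card (Gluings N (blockRotate
          (Sum.elim ![n i + n j + 2] (fun k : {k : Fin L // k ≠ i ∧ k ≠ j} => n k)))) := by
      intro i j hij
      have e : ∑ k, n k = n i + n j + ∑ k : {k : Fin L // k ≠ i ∧ k ≠ j}, n k := by
        rw [← Finset.sum_add_sum_compl {i, j} n, Finset.sum_pair hij.ne]
        congr 1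
        exact Finset.sum_subtype _ (fun k => by simp) n
      have e' : L = 2 + Fintype.card {k : Fin L // k ≠ i ∧ k ≠ j} := by
        have := Finset.card_add_card_compl ({i, j} : Finset (Fin L))
        rw [Finset.card_pair hij.ne, Fintype.card_fin] at this
        rw [Fintype.card_of_subtype ({i, j}ᶜ : Finset (Fin L)) (fun k => by simp)]
        exact this.symm
      rw [← mul_gluingCount (N := N) ?_ (Int.natCast_nonneg g) hN0 ?_]
      · push_cast
        rfl
      · rintro (u | k)
        · simp
        · exact hn k
      · simp only [Fintype.sum_sum_type, Fintype.card_sum, Sum.elim_inl, Sum.elim_inr,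
          Fintype.card_fin, Fin.sum_univ_one, Matrix.cons_val_zero]
        omega
    have hsplit : ∀ i : Fin L, ∀ x ∈ Finset.Icc 1 (n i + 1), (N : ℤ) * gluingCount ((g : ℤ) - 1)
        (Sum.elim ![n i + 2 - x, x] (fun k : {k : Fin L // k ≠ i} => n k)) =
        Nat.card (Gluings N (blockRotate
          (Sum.elim ![n i + 2 - x, x] (fun k : {k : Fin L // k ≠ i} => n k)))) := by
      intro i x hx
      rw [Finset.mem_Icc] at hx
      have e : ∑ k, n k = n i + ∑ k : {k : Fin L // k ≠ i}, n k := by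
        rw [← Finset.sum_add_sum_compl {i} n, Finset.sum_singleton]
        congr 1
        exact Finset.sum_subtype _ (fun k => by simp) n
      have e' : L = 1 + Fintype.card {k : Fin L // k ≠ i} := by
        have := Finset.card_add_card_compl ({i} : Finset (Fin L))
        rw [Finset.card_singleton, Fintype.card_fin] at this
        rw [Fintype.card_of_subtype ({i}ᶜ : Finset (Fin L)) (fun k => by simp)]
        exact this.symm
      have hpos : ∀ k, 0 < Sum.elim ![n i + 2 - x, x] (fun k : {k : Fin L // k ≠ i} => n k) k := by
        rintro (u | k)
        · match u with
          | 0 => simp; omega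
          | 1 => simp; omega
        · exact hn k
      have es : ∑ k, Sum.elim ![n i + 2 - x, x] (fun k : {k : Fin L // k ≠ i} => n k) k =
          n i + 2 + ∑ k : {k : Fin L // k ≠ i}, n k := by
        simp only [Fintype.sum_sum_type, Sum.elim_inl, Sum.elim_inr, Fin.sum_univ_two,
          Matrix.cons_val_zero, Matrix.cons_val_one]
        omega
      rcases Nat.eq_zero_or_pos g with rfl | hg
      -- In genus 0 the count is 0 by convention, while the gluings on the right are excluded by the
      -- genus bound.
      · have : IsEmpty (Gluings N (blockRotate
            (Sum.elim ![n i + 2 - x, x] (fun k : {k : Fin L // k ≠ i} => n k)))) := by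
          refine ⟨fun q => ?_⟩
          have := q.2.two_mul_card_le hpos hN0
          rw [es, Fintype.card_sum, Fintype.card_fin] at this
          omega
        rw [Nat.card_of_isEmpty]
        simp [gluingCount]
      · rw [← mul_gluingCount (N := N) (g := (g : ℤ) - 1) hpos (by omega) hN0 ?_]
        · push_cast
          rfl
        · rw [es, Fintype.card_sum, Fintype.card_fin]
          omega
    have key := card_gluings_blockRotate_mul (N := N) hn
    rw [← hfull] at key
    rw [Finset.sum_congr rfl fun i _ => Finset.sum_congr rfl fun j hj =>
      congrArg _ (hmerge i j (Finset.mem_filter.1 hj).2).symm] at key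
    rw [Finset.sum_congr rfl fun i (_ : i ∈ Finset.univ) =>
      congrArg ((n i : ℤ) * ·) (Finset.sum_congr rfl fun x hx => (hsplit i x hx).symm)] at key
    have key := congrArg (Int.cast : ℤ → ℚ) key
    have hNQ : (N : ℚ) + 2 = (∑ i, n i : ℕ) + 2 * L + 4 * g := by exact_mod_cast hN
    have hNne : (N : ℚ) ≠ 0 := by exact_mod_cast hN0.ne'
    push_cast at key hNQ
    simp only [← Finset.mul_sum, mul_left_comm _ (N : ℚ)] at key
    apply mul_left_cancel₀ hNne
    -- The number of glued sides, twice the number of glued pairs.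
    have e : (N : ℚ) - ∑ i, (n i : ℚ) = 2 * (L + 2 * g - 1) := by linarith
    rw [e] at key
    linear_combination key / 2
  · intro m hm
    have h := mul_gluingCount (N := m) (n := ![m]) (g := 0) (by simpa using hm) le_rfl hm (by simp)
    rw [card_gluings_fin hm] at h
    exact Nat.eq_of_mul_eq_mul_left hm (h.trans (mul_one m).symm)

end Main
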